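/- Throughout, a permutation $\pi$ of length $N\ge 1$ is identified with its plot, the set of points $(i,\pi(i))$, $1\le i\le N$. It contains a permutation $\sigma$ if some subset of its points is order isomorphic to $\sigma$. An interval of $\pi$ is a nonempty set of points $\{(i,\pi(i)):i\in I\}$ such that both $I$ and $\pi(I)$ are sets of consecutive integers; $\pi$ is simple if $N\ge 2$ and its only intervals are the single points and the whole of $\pi$. The sum of $k$ copies of $21$ is the permutation $2\,1\,4\,3\,6\,5\cdots(2k)\,(2k-1)$. A point $(x,y)$ slices a set of points with rectangular hull $[a,b]\times[c,d]$ if either $x\in(a,b)$ and $y\notin[c,d]$, or $x\notin[a,b]$ and $y\in(c,d)$; it is then called an up, down, right or left pin, according to the side of the rectangle on which it lies. A sawtooth alternation of length $3n$ is a permutation on $3n$ points that consists of a sum of $n$ copies of $21$ and a monotone sequence of $n$ points lying entirely above, entirely below, entirely to the right or entirely to the left of that sum, such that each of the $n$ copies of $21$ is sliced by exactly one entry of the monotone sequence. It is a parallel sawtooth alternation if the monotone sequence is increasing, and a wedge sawtooth alternation if it is decreasing. A proper pin sequence in a permutation is a sequence of distinct points $p_1,p_2,\dots,p_m$ such that,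 for every $i\ge 3$, the point $p_i$ slices $\{p_1,\dots,p_{i-1}\}$ and is extremal in its direction among all points that do so (for example, if $p_i$ is a right pin, no point further to the right slices $\{p_1,\dots,p_{i-1}\}$), and such that, for every $2\le i<m$, the point $p_{i+1}$ lies horizontally or vertically between $p_i$ and the rectangular hull of $\{p_1,\dots,p_{i-1}\}$. An increasing oscillation of length $n$ is a permutation on $n$ points all of whose points can be listed as a proper pin sequence $p_1,\dots,p_n$ in which $p_1,p_2$ form a copy of $21$ (if $n\ge2$) and every $p_i$ with $i\ge3$ is a right pin or an up pin. Theorem. There is a function $f:\mathbb{N}\to\mathbb{N}$ such that, for every $n$, every simple permutation that contains a sum of $f(n)$ copies of $21$ contains a parallel sawtooth alternation of length $3n$, a wedge sawtooth alternation of length $3n$, or an increasing oscillation of length $n$. -/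

import Mathlib

/-! A permutation `π` of length `N` is an element of `Equiv.Perm (Fin N)`.  Its plot is the set of
points `(i, π i)`, so a point of the plot is given by its position `i : Fin N`, and a set of points
of the plot is given by a `Finset (Fin N)`. -/

namespace PermPattern

/-- `π` contains `σ`: some subsequence of `π` is order isomorphic to `σ`. -/
def Contains {N k : ℕ} (π : Equiv.Perm (Fin N)) (σ : Equiv.Perm (Fin k)) : Prop :=
  ∃ e : Fin k ↪o Fin N, ∀ i j : Fin k, π (e i) < π (e j) ↔ σ i < σ j

/-- An interval: a nonempty set `I` of positions such that both `I` and `π(I)` are contiguous. -/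
def IsInterval {N : ℕ} (π : Equiv.Perm (Fin N)) (I : Set (Fin N)) : Prop :=
  I.Nonempty ∧ I.OrdConnected ∧ (π '' I).OrdConnected

/-- A permutation of length at least two is simple if its only intervals are the singletons and
the whole permutation. -/
def IsSimple {N : ℕ} (π : Equiv.Perm (Fin N)) : Prop :=
  2 ≤ N ∧ ∀ I : Set (Fin N), IsInterval π I → (∃ i, I = {i}) ∨ I = Set.univ

/-- The sum of `n` copies of `21`, i.e. the permutation `2 1 4 3 6 5 …` of length `n * 2`:
the position `2 * i + j` (with `i < n` and `j < 2`) is sent to the value `2 * i + (1 - j)`. -/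
def sumOf21 (n : ℕ) : Equiv.Perm (Fin (n * 2)) :=
  finProdFinEquiv.permCongr (Equiv.prodCongr (Equiv.refl (Fin n)) (Equiv.swap (0 : Fin 2) 1))

/-! ### Relative positions of a point and a set of points -/

/-- `q` lies to the right of (the rectangular hull of) `S`. -/
def RightOf {N : ℕ} (S : Finset (Fin N)) (q : Fin N) : Prop := ∀ s ∈ S, s < q

/-- `q` lies to the left of `S`. -/
def LeftOf {N : ℕ} (S : Finset (Fin N)) (q : Fin N) : Prop := ∀ s ∈ S, q < s

/-- `q` lies above `S`. -/
def Above {N : ℕ} (π : Equiv.Perm (Fin N)) (S : Finset (Fin N)) (q : Fin N) : Prop :=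
  ∀ s ∈ S, π s < π q

/-- `q` lies below `S`. -/
def Below {N : ℕ} (π : Equiv.Perm (Fin N)) (S : Finset (Fin N)) (q : Fin N) : Prop :=
  ∀ s ∈ S, π q < π s

/-- The horizontal coordinate of `q` lies in the open interval `(a, b)`, where `[a, b] × [c, d]` is
the rectangular hull of `S`. -/
def WithinX {N : ℕ} (S : Finset (Fin N)) (q : Fin N) : Prop :=
  (∃ s ∈ S, s < q) ∧ ∃ s ∈ S, q < s

/-- The vertical coordinate of `q` lies in the open interval `(c, d)`, where `[a, b] × [c, d]` is
the rectangular hull of `S`. -/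
def WithinY {N : ℕ} (π : Equiv.Perm (Fin N)) (S : Finset (Fin N)) (q : Fin N) : Prop :=
  (∃ s ∈ S, π s < π q) ∧ ∃ s ∈ S, π q < π s

/-- `q` is an up pin for `S`: it slices the rectangular hull of `S` from above. -/
def IsUpPin {N : ℕ} (π : Equiv.Perm (Fin N)) (S : Finset (Fin N)) (q : Fin N) : Prop :=
  WithinX S q ∧ Above π S q

/-- `q` is a down pin for `S`. -/
def IsDownPin {N : ℕ} (π : Equiv.Perm (Fin N)) (S : Finset (Fin N)) (q : Fin N) : Prop :=
  WithinX S q ∧ Below π S q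

/-- `q` is a right pin for `S`. -/
def IsRightPin {N : ℕ} (π : Equiv.Perm (Fin N)) (S : Finset (Fin N)) (q : Fin N) : Prop :=
  WithinY π S q ∧ RightOf S q

/-- `q` is a left pin for `S`. -/
def IsLeftPin {N : ℕ} (π : Equiv.Perm (Fin N)) (S : Finset (Fin N)) (q : Fin N) : Prop :=
  WithinY π S q ∧ LeftOf S q

/-- `q` slices the rectangular hull of `S`, vertically or horizontally. -/
def Slices {N : ℕ} (π : Equiv.Perm (Fin N)) (S : Finset (Fin N)) (q : Fin N) : Prop :=
  (IsUpPin π S q ∨ IsDownPin π S q) ∨ (IsRightPin π S q ∨ IsLeftPin π S q)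

/-! ### Sawtooth alternations -/

/-- The points of `σ` at the positions `s` (a sum of `n` copies of `21`) and `m` (a sequence of
`n` points) together make up `σ`, the points of `m` are alongside the sum of `21`s (all above it,
all below it, all to its right, or all to its left), and each copy of `21` is sliced by a single
entry of `m`.  The `k`-th copy of `21` consists of the entries `2 * k` and `2 * k + 1` of `s`. -/
def IsSawtoothWith {n : ℕ} (σ : Equiv.Perm (Fin (3 * n)))
    (s : Fin (n * 2) ↪o Fin (3 * n)) (m : Fin n ↪o Fin (3 * n)) : Prop :=
  (∀ i j, s i ≠ m j) ∧
  (∀ i j, σ (s i) < σ (s j) ↔ sumOf21 n i < sumOf21 n j) ∧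
  ((∀ j, Above σ (Finset.univ.image s) (m j)) ∨ (∀ j, Below σ (Finset.univ.image s) (m j)) ∨
    (∀ j, RightOf (Finset.univ.image s) (m j)) ∨ (∀ j, LeftOf (Finset.univ.image s) (m j))) ∧
  ∀ k : Fin n, ∃! j : Fin n,
    Slices σ {s (finProdFinEquiv (k, 0)), s (finProdFinEquiv (k, 1))} (m j)

/-- A parallel sawtooth alternation of length `3 * n`: the monotone sequence is increasing. -/
def IsParallelSawtooth {n : ℕ} (σ : Equiv.Perm (Fin (3 * n))) : Prop :=
  ∃ (s : Fin (n * 2) ↪o Fin (3 * n)) (m : Fin n ↪o Fin (3 * n)),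
    IsSawtoothWith σ s m ∧ StrictMono (fun j => σ (m j))

/-- A wedge sawtooth alternation of length `3 * n`: the monotone sequence is decreasing. -/
def IsWedgeSawtooth {n : ℕ} (σ : Equiv.Perm (Fin (3 * n))) : Prop :=
  ∃ (s : Fin (n * 2) ↪o Fin (3 * n)) (m : Fin n ↪o Fin (3 * n)),
    IsSawtoothWith σ s m ∧ StrictAnti (fun j => σ (m j))

/-! ### Pin sequences and increasing oscillations

A sequence `p₁, …, pₘ` is written `p : Fin m → Fin N`, with indices starting from `0`. -/

/-- The set of the points of the sequence `p` that come before the point of index `i`. -/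
def before {m N : ℕ} (p : Fin m → Fin N) (i : Fin m) : Finset (Fin N) :=
  (Finset.univ.filter (fun j => j < i)).image p

/-- A pin sequence: from the third point on, every point slices the rectangular hull of its
predecessors. -/
def IsPinSequence {m N : ℕ} (π : Equiv.Perm (Fin N)) (p : Fin m → Fin N) : Prop :=
  Function.Injective p ∧ ∀ i : Fin m, 2 ≤ i.val → Slices π (before p i) (p i)

/-- Maximality: each pin is maximal in its direction. -/
def IsMaximalPins {m N : ℕ} (π : Equiv.Perm (Fin N)) (p : Fin m → Fin N) : Prop :=
  ∀ i : Fin m, 2 ≤ i.val → ∀ q : Fin N,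
    (IsUpPin π (before p i) (p i) → IsUpPin π (before p i) q → π q ≤ π (p i)) ∧
    (IsDownPin π (before p i) (p i) → IsDownPin π (before p i) q → π (p i) ≤ π q) ∧
    (IsRightPin π (before p i) (p i) → IsRightPin π (before p i) q → q ≤ p i) ∧
    (IsLeftPin π (before p i) (p i) → IsLeftPin π (before p i) q → p i ≤ q)

/-- `r` lies horizontally or vertically between the rectangular hull of `S` and the point `q`. -/
def Separates {N : ℕ} (π : Equiv.Perm (Fin N)) (S : Finset (Fin N)) (q r : Fin N) : Prop :=
  (RightOf S r ∧ r < q) ∨ (LeftOf S r ∧ q < r) ∨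
    (Above π S r ∧ π r < π q) ∨ (Below π S r ∧ π q < π r)

/-- Separation: each pin separates its predecessor from all the earlier points. -/
def IsSeparatedPins {m N : ℕ} (π : Equiv.Perm (Fin N)) (p : Fin m → Fin N) : Prop :=
  ∀ i j : Fin m, 1 ≤ i.val → j.val = i.val + 1 → Separates π (before p i) (p i) (p j)

/-- A proper pin sequence. -/
def IsProperPinSequence {m N : ℕ} (π : Equiv.Perm (Fin N)) (p : Fin m → Fin N) : Prop :=
  IsPinSequence π p ∧ IsMaximalPins π p ∧ IsSeparatedPins π p

/-- The two points `a` and `b` form a copy of `21`. -/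
def Form21 {N : ℕ} (π : Equiv.Perm (Fin N)) (a b : Fin N) : Prop :=
  (a < b ∧ π b < π a) ∨ (b < a ∧ π a < π b)

/-- An increasing oscillation of length `n`: a permutation on `n` points formed by a proper pin
sequence that starts from a copy of `21` and then is entirely made up of right and up pins. -/
def IsIncreasingOscillation {n : ℕ} (σ : Equiv.Perm (Fin n)) : Prop :=
  ∃ p : Fin n → Fin n, Function.Bijective p ∧ IsProperPinSequence σ p ∧
    (∀ i j : Fin n, i.val = 0 → j.val = 1 → Form21 σ (p i) (p j)) ∧
    ∀ i : Fin n, 2 ≤ i.val →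
      IsRightPin σ (before p i) (p i) ∨ IsUpPin σ (before p i) (p i)

end PermPattern

/-! The argument takes place in the inversion graph of `π`, in which two points are adjacent when
they form a copy of `21`. A point slices a copy of `21` exactly when it is adjacent to one of its
two points and not to the other. Three facts link this graph to the statement. An induced path on
`n` vertices is an increasing oscillation (`IsInducedPath.exists_oscillation`). Every set of points
that is connected in the graph, has at least two points and whose hull is not everything contains a
copy of `21` that is sliced by an outside point, as `π` is simple
(`PermPattern.IsSimple.exists_slicer`). Finally, copies of `21` in a sum, each with a pin beyond
all of them on one common side, form a sawtooth alternation once the pins are monotone.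

Let `B₀ < B₁ < ⋯ < B_{w-1}` be a sum of copies of `21`, and let the extent of a point be the
interval of the indices `k` for which `B_k` is not comparable with the point, in the order of the
plot. A long pin is a point `q` that slices a copy of `21` placed below and to the left of `s`
consecutive `B_k` (or above and to their right) and that passes all of these `B_k`. The heart of
the proof is that, if `w` is large compared with `s` and `n`, there is a long pin or an induced path
on `n` vertices (`IsSumOf21.exists_longPin`). Indeed, suppose that there is neither.

* The extent of a point that slices an edge exceeds that of the edge by at most `s + 3` on either
  side (`IsSumOf21.extent_le`). Applied to well-chosen edges this shows that extents are laminar up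
  to a bounded error (`IsSumOf21.not_crossing`).
* Fix an index `i` and an interval `[A, B]` around it. The component of `B_i` among the points of
  extent within `[A, B]` has a slicer, which leaves the interval, so some point of the component
  nearly reaches `A` or `B`. A shortest path from `B_i` to it has fewer than `n` steps, and extents
  grow by at most `s + 3` along it, so already its second point, whose extent contains `i`, nearly
  reaches `A` or `B` (`IsSumOf21.exists_extent`).
* These two properties contradict each other: an extent that starts at the right end of some given
  extent of moderate length can be forced to reach the far right of the sum, and symmetrically on
  the left, and two such extents can be made to cross.

Long pins are now found repeatedly, each inside the stretch of the sum passed by the previous one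
(`exists_isPinFamily`). Among sufficiently many of them, many have the same direction and monotone
heights, and these form a sawtooth alternation. -/

open PermPattern

/-! ### Points of the plot and patterns -/

/-- The strict componentwise order on the plot: `j` lies above and to the right of `i`. -/
def BelowLeft {N : ℕ} (π : Equiv.Perm (Fin N)) (i j : Fin N) : Prop := i < j ∧ π i < π j

theorem BelowLeft.trans {N : ℕ} {π : Equiv.Perm (Fin N)} {i j k : Fin N}
    (h : BelowLeft π i j) (h' : BelowLeft π j k) : BelowLeft π i k :=
  ⟨h.1.trans h'.1, h.2.trans h'.2⟩

/-- The inversion graph of `π`: two points are adjacent if they form a copy of `21`. -/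
def inversionGraph {N : ℕ} (π : Equiv.Perm (Fin N)) : SimpleGraph (Fin N) where
  Adj := Form21 π
  symm := ⟨fun _ _ h => h.symm⟩
  loopless := ⟨fun i h => by
    rcases h with h | h <;> exact lt_irrefl _ h.1⟩

theorem PermPattern.Form21.symm {N : ℕ} {π : Equiv.Perm (Fin N)} {i j : Fin N} (h : Form21 π i j) :
    Form21 π j i := Or.symm h

theorem form21_or_belowLeft {N : ℕ} (π : Equiv.Perm (Fin N)) {i j : Fin N} (h : i ≠ j) :
    Form21 π i j ∨ BelowLeft π i j ∨ BelowLeft π j i := by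
  have h' : π i ≠ π j := fun e => h (π.injective e)
  unfold Form21 BelowLeft
  rcases lt_or_gt_of_ne h with h1 | h1 <;> rcases lt_or_gt_of_ne h' with h2 | h2 <;> tauto

theorem BelowLeft.not_form21 {N : ℕ} {π : Equiv.Perm (Fin N)} {i j : Fin N}
    (h : BelowLeft π i j) : ¬ Form21 π i j := by
  rintro (h' | h')
  · exact lt_asymm h.2 h'.2
  · exact lt_asymm h.1 h'.1

theorem BelowLeft.not_form21' {N : ℕ} {π : Equiv.Perm (Fin N)} {i j : Fin N}
    (h : BelowLeft π i j) : ¬ Form21 π j i := fun h' => h.not_form21 h'.symm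

/-- Every set of points of the plot is order isomorphic to a permutation. -/
theorem exists_pattern {N k : ℕ} (π : Equiv.Perm (Fin N)) (T : Finset (Fin N)) (hT : T.card = k) :
    ∃ (σ : Equiv.Perm (Fin k)) (e : Fin k ↪o Fin N), (∀ x, x ∈ T ↔ ∃ i, e i = x) ∧
      ∀ i j, π (e i) < π (e j) ↔ σ i < σ j := by
  have hT' : (T.map π.toEmbedding).card = k := by simpa using hT
  let f := (T.map π.toEmbedding).orderIsoOfFin hT'
  let g := T.orderIsoOfFin hT
  let m : {x // x ∈ T} ≃ {x // x ∈ T.map π.toEmbedding} :=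
    π.subtypeEquiv fun a => by simp
  refine ⟨(g.toEquiv.trans m).trans f.symm.toEquiv, T.orderEmbOfFin hT, fun x => ?_, fun i j => ?_⟩
  · have := T.range_orderEmbOfFin hT
    rw [← Finset.mem_coe, ← this]; rfl
  · have : ∀ i, π (T.orderEmbOfFin hT i) = (m (g i) : Fin N) := fun i => rfl
    rw [this, this]
    simp

/-! ### Increasing oscillations -/

/-- In a sequence whose consecutive terms are incomparable and whose other pairs are comparable,
the comparison of the first and third terms determines all the others. -/
theorem rel_of_path {α : Type*} (R : α → α → Prop)
    (trans : ∀ {x y z}, R x y → R y z → R x z) (y : ℕ → α) (n : ℕ)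
    (hadj : ∀ i, i + 1 < n → ¬ R (y i) (y (i + 1)) ∧ ¬ R (y (i + 1)) (y i))
    (hcomp : ∀ i j, i + 2 ≤ j → j < n → R (y i) (y j) ∨ R (y j) (y i))
    (h02 : 2 < n → R (y 0) (y 2)) :
    ∀ i j, i + 2 ≤ j → j < n → R (y i) (y j) := by
  have row : ∀ i, (i + 2 < n → R (y i) (y (i + 2))) → ∀ j, i + 2 ≤ j → j < n → R (y i) (y j) := by
    intro i hi j hj
    induction j, hj using Nat.le_induction with
    | base => exact hi
    | succ j hj ih =>
      intro hn
      rcases hcomp i (j + 1) (by omega) hn with h | h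
      · exact h
      · exact absurd (trans h (ih (by omega))) (hadj j hn).2
  intro i
  induction i with
  | zero => exact row 0 h02
  | succ i ih =>
    refine row (i + 1) fun hn => ?_
    rcases hcomp (i + 1) (i + 1 + 2) le_rfl hn with h | h
    · exact h
    · exact absurd (trans (ih (i + 1 + 2) (by omega) hn) h) (hadj i (by omega)).1

theorem mem_before {m N : ℕ} {p : Fin m → Fin N} {i : Fin m} {x : Fin N} :
    x ∈ before p i ↔ ∃ j, j < i ∧ p j = x := by
  simp [before]

theorem isIncreasingOscillation_of_path {n : ℕ} {σ : Equiv.Perm (Fin n)} (p : Fin n → Fin n)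
    (hp : Function.Bijective p)
    (hadj : ∀ i j : Fin n, j.val = i.val + 1 → Form21 σ (p i) (p j))
    (hlt : ∀ i j : Fin n, i.val + 2 ≤ j.val → BelowLeft σ (p i) (p j)) :
    IsIncreasingOscillation σ := by
  have hpin : ∀ i : Fin n, 2 ≤ i.val →
      IsRightPin σ (before p i) (p i) ∨ IsUpPin σ (before p i) (p i) := by
    intro i hi
    let i0 : Fin n := ⟨0, by omega⟩
    let i1 : Fin n := ⟨i.val - 1, by omega⟩
    have m0 : p i0 ∈ before p i := mem_before.2 ⟨i0, by simp [Fin.lt_def, i0]; omega, rfl⟩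
    have m1 : p i1 ∈ before p i := mem_before.2 ⟨i1, by simp [Fin.lt_def, i1]; omega, rfl⟩
    have h0 := hlt i0 i (by simp [i0]; omega)
    have key : ∀ s ∈ before p i, s = p i1 ∨ BelowLeft σ s (p i) := by
      intro s hs
      obtain ⟨j, hj, rfl⟩ := mem_before.1 hs
      by_cases h : j.val + 2 ≤ i.val
      · exact Or.inr (hlt j i h)
      · left; congr 1; ext; simp only [i1]; have := Fin.lt_def.1 hj; omega
    rcases hadj i1 i (by simp [i1]; omega) with h | h
    · left
      refine ⟨⟨⟨_, m0, h0.2⟩, ⟨_, m1, h.2⟩⟩, fun s hs => ?_⟩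
      rcases key s hs with rfl | h'
      · exact h.1
      · exact h'.1
    · right
      refine ⟨⟨⟨_, m0, h0.1⟩, ⟨_, m1, h.1⟩⟩, fun s hs => ?_⟩
      rcases key s hs with rfl | h'
      · exact h.2
      · exact h'.2
  -- The only point that slices the first `i` points is the next one.
  have huniq : ∀ i q, WithinX (before p i) q ∨ WithinY σ (before p i) q →
      RightOf (before p i) q ∨ LeftOf (before p i) q ∨ Above σ (before p i) q ∨
        Below σ (before p i) q → q = p i := by
    intro i q hw ho
    obtain ⟨k, rfl⟩ := hp.2 q
    rcases lt_trichotomy k i with h | h | h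
    · have hk : p k ∈ before p i := mem_before.2 ⟨k, h, rfl⟩
      rcases ho with h' | h' | h' | h' <;> exact absurd (h' _ hk) (lt_irrefl _)
    · rw [h]
    · exfalso
      have key : ∀ s ∈ before p i, BelowLeft σ s (p k) := by
        intro s hs
        obtain ⟨j, hj, rfl⟩ := mem_before.1 hs
        exact hlt j k (by have := Fin.lt_def.1 hj; have := Fin.lt_def.1 h; omega)
      rcases hw with ⟨-, s, hs, h'⟩ | ⟨-, s, hs, h'⟩
      · exact lt_asymm (key s hs).1 h'
      · exact lt_asymm (key s hs).2 h'
  refine ⟨p, hp, ⟨⟨hp.1, fun i hi => ?_⟩, fun i hi q => ⟨fun _ h => ?_, fun _ h => ?_,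
    fun _ h => ?_, fun _ h => ?_⟩, fun i j hi hj => ?_⟩, fun i j hi hj => hadj i j (by omega), hpin⟩
  · rcases hpin i hi with h | h
    · exact Or.inr (Or.inl h)
    · exact Or.inl (Or.inl h)
  · rw [huniq i q (Or.inl h.1) (Or.inr (Or.inr (Or.inl h.2)))]
  · rw [huniq i q (Or.inl h.1) (Or.inr (Or.inr (Or.inr h.2)))]
  · rw [huniq i q (Or.inr h.1) (Or.inl h.2)]
  · rw [huniq i q (Or.inr h.1) (Or.inr (Or.inl h.2))]
  · have key : ∀ s ∈ before p i, BelowLeft σ s (p j) := by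
      intro s hs
      obtain ⟨k, hk, rfl⟩ := mem_before.1 hs
      exact hlt k j (by have := Fin.lt_def.1 hk; omega)
    rcases hadj i j hj with h | h
    · exact Or.inr (Or.inr (Or.inl ⟨fun s hs => (key s hs).2, h.2⟩))
    · exact Or.inl ⟨fun s hs => (key s hs).1, h.1⟩

/-- A sequence of `n` points of the plot that is an induced path of the inversion graph. -/
def IsInducedPath {N : ℕ} (π : Equiv.Perm (Fin N)) (n : ℕ) (y : ℕ → Fin N) : Prop :=
  (∀ i, i + 1 < n → Form21 π (y i) (y (i + 1))) ∧
    ∀ i j, i + 2 ≤ j → j < n → y i ≠ y j ∧ ¬ Form21 π (y i) (y j)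

theorem exists_oscillation_of_oriented_path {N n : ℕ} {π : Equiv.Perm (Fin N)} {y : ℕ → Fin N}
    (hadj : ∀ i, i + 1 < n → Form21 π (y i) (y (i + 1)))
    (hlt : ∀ i j, i + 2 ≤ j → j < n → BelowLeft π (y i) (y j)) :
    ∃ σ : Equiv.Perm (Fin n), IsIncreasingOscillation σ ∧ Contains π σ := by
  have hne : ∀ i j, i < j → j < n → y i ≠ y j := by
    intro i j hij hj h
    by_cases h1 : j = i + 1
    · subst h1
      have := hadj i hj
      rw [h] at this
      exact (inversionGraph π).loopless.irrefl _ this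
    · have := (hlt i j (by omega) hj).1
      rw [h] at this
      exact lt_irrefl _ this
  have hinj : Function.Injective (fun i : Fin n => y i) := by
    intro i j h
    by_contra hij
    rcases lt_or_gt_of_ne hij with h' | h'
    · exact hne _ _ h' j.2 h
    · exact hne _ _ h' i.2 h.symm
  obtain ⟨σ, e, he, hσ⟩ := exists_pattern (k := n) π (Finset.univ.image fun i : Fin n => y i)
    (by rw [Finset.card_image_of_injective _ hinj]; simp)
  have : ∀ i : Fin n, ∃ j, e j = y i := fun i => (he _).1 (by simp)
  choose p hp using this
  have hpinj : Function.Injective p := fun i j h => hinj (by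
    change y i = y j
    rw [← hp, ← hp, h])
  refine ⟨σ, isIncreasingOscillation_of_path p (Finite.injective_iff_bijective.1 hpinj) ?_ ?_, e,
    hσ⟩
  · intro i j hij
    have := hadj i (by omega)
    rw [← hij, ← hp, ← hp] at this
    simpa [Form21, hσ] using this
  · intro i j hij
    have := hlt i j hij j.2
    rw [← hp, ← hp] at this
    simpa [BelowLeft, hσ] using this

theorem IsInducedPath.exists_oscillation {N n : ℕ} {π : Equiv.Perm (Fin N)} {y : ℕ → Fin N}
    (hy : IsInducedPath π n y) :
    ∃ σ : Equiv.Perm (Fin n), IsIncreasingOscillation σ ∧ Contains π σ := by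
  obtain ⟨hadj, hnon⟩ := hy
  have hcomp : ∀ i j, i + 2 ≤ j → j < n →
      BelowLeft π (y i) (y j) ∨ BelowLeft π (y j) (y i) := by
    intro i j hij hj
    have := form21_or_belowLeft π (hnon i j hij hj).1
    have := (hnon i j hij hj).2
    tauto
  by_cases h2 : 2 < n → BelowLeft π (y 0) (y 2)
  · exact exists_oscillation_of_oriented_path hadj <|
      rel_of_path (BelowLeft π) BelowLeft.trans y n
        (fun i hi => ⟨fun h => h.not_form21 (hadj i hi), fun h => h.not_form21' (hadj i hi)⟩)
        hcomp h2
  · -- The path runs downwards: list it backwards.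
    push Not at h2
    have hR := rel_of_path (fun a b => BelowLeft π b a) (fun h h' => h'.trans h) y n
      (fun i hi => ⟨fun h => h.not_form21' (hadj i hi), fun h => h.not_form21 (hadj i hi)⟩)
      (fun i j hij hj => (hcomp i j hij hj).symm)
      (fun h => (hcomp 0 2 le_rfl h).resolve_left h2.2)
    refine exists_oscillation_of_oriented_path (y := fun i => y (n - 1 - i)) (fun i hi => ?_)
      (fun i j hij hj => hR _ _ (by omega) (by omega))
    have := hadj (n - 1 - (i + 1)) (by omega)
    rw [show n - 1 - (i + 1) + 1 = n - 1 - i by omega] at this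
    exact this.symm

/-! ### Sawtooth alternations -/

theorem slices_pair_iff {N : ℕ} {π : Equiv.Perm (Fin N)} {u v q : Fin N}
    (h : u < v) (h' : π v < π u) :
    Slices π {u, v} q ↔ (u < q ∧ q < v ∧ (π u < π q ∨ π q < π v)) ∨
      (π v < π q ∧ π q < π u ∧ (v < q ∨ q < u)) := by
  simp only [Slices, IsUpPin, IsDownPin, IsRightPin, IsLeftPin, WithinX, WithinY, Above, Below,
    RightOf, LeftOf, Finset.mem_insert, Finset.mem_singleton, forall_eq_or_imp, forall_eq,
    exists_eq_or_imp, exists_eq_left]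
  omega

theorem sumOf21_apply (n : ℕ) (k : Fin n) (a : Fin 2) :
    sumOf21 n (finProdFinEquiv (k, a)) = finProdFinEquiv (k, Equiv.swap 0 1 a) := by
  simp [sumOf21, Equiv.permCongr_apply]

/-- The points `a k` (upper left) and `b k` (lower right), for `k < w`, form a sum of `w` copies
of `21`. -/
structure IsSumOf21 {N : ℕ} (π : Equiv.Perm (Fin N)) (w : ℕ) (a b : ℕ → Fin N) : Prop where
  lt : ∀ k, k < w → a k < b k
  gt : ∀ k, k < w → π (b k) < π (a k)
  right : ∀ k l, k < l → l < w → b k < a l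
  above : ∀ k l, k < l → l < w → π (a k) < π (b l)

theorem exists_isSumOf21 {N w : ℕ} {π : Equiv.Perm (Fin N)} (h : Contains π (sumOf21 w))
    (x : Fin N) : ∃ a b, IsSumOf21 π w a b := by
  obtain ⟨e, he⟩ := h
  refine ⟨fun k => if hk : k < w then e (finProdFinEquiv (⟨k, hk⟩, 0)) else x,
    fun k => if hk : k < w then e (finProdFinEquiv (⟨k, hk⟩, 1)) else x, ?_, ?_, ?_, ?_⟩
  · intro k hk
    simp [hk, Fin.lt_def]
  · intro k hk
    simp [hk, he, sumOf21_apply, Fin.lt_def]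
  · intro k l hkl hl
    have hk : k < w := hkl.trans hl
    simp [hk, hl, Fin.lt_def]
    omega
  · intro k l hkl hl
    have hk : k < w := hkl.trans hl
    simp [hk, hl, he, sumOf21_apply, Fin.lt_def]
    omega

theorem IsSumOf21.comp {N w r : ℕ} {π : Equiv.Perm (Fin N)} {a b : ℕ → Fin N}
    (h : IsSumOf21 π w a b) {g : ℕ → ℕ} (hg : ∀ i j, i < j → j < r → g i < g j)
    (hr : ∀ i, i < r → g i < w) : IsSumOf21 π r (a ∘ g) (b ∘ g) :=
  ⟨fun k hk => h.lt _ (hr k hk), fun k hk => h.gt _ (hr k hk),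
    fun k l hkl hl => h.right _ _ (hg k l hkl hl) (hr l hl),
    fun k l hkl hl => h.above _ _ (hg k l hkl hl) (hr l hl)⟩

/-- A sawtooth alternation can be assembled from its points within a larger permutation. -/
theorem exists_sawtooth_of_slices {N n : ℕ} {π : Equiv.Perm (Fin N)} {a b : ℕ → Fin N}
    (hab : IsSumOf21 π n a b) (m : Fin n → Fin N) (hm : StrictMono m)
    (side : (∀ k < n, ∀ j, π (a k) < π (m j)) ∨ (∀ k < n, ∀ j, π (m j) < π (b k)) ∨
      (∀ k < n, ∀ j, b k < m j) ∨ (∀ k < n, ∀ j, m j < a k))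
    (slices : ∀ k : Fin n, ∃! j : Fin n, Slices π {a k, b k} (m j))
    (mono : StrictMono (fun j => π (m j)) ∨ StrictAnti (fun j => π (m j))) :
    ∃ σ : Equiv.Perm (Fin (3 * n)),
      (IsParallelSawtooth σ ∨ IsWedgeSawtooth σ) ∧ Contains π σ := by
  let s : Fin (n * 2) → Fin N := fun i =>
    if (finProdFinEquiv.symm i).2 = 0 then a (finProdFinEquiv.symm i).1
    else b (finProdFinEquiv.symm i).1
  have s0 : ∀ k : Fin n, s (finProdFinEquiv (k, 0)) = a k := fun k => by
    simp only [s, Equiv.symm_apply_apply, if_true]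
  have s1 : ∀ k : Fin n, s (finProdFinEquiv (k, 1)) = b k := fun k => by
    simp only [s, Equiv.symm_apply_apply, one_ne_zero, if_false]
  have hs : StrictMono s := by
    intro i j hij
    obtain ⟨⟨k, c⟩, rfl⟩ := finProdFinEquiv.surjective i
    obtain ⟨⟨l, d⟩, rfl⟩ := finProdFinEquiv.surjective j
    rw [Fin.lt_def] at hij
    simp only [finProdFinEquiv_apply_val] at hij
    have hk := hab.lt k k.2
    have hl := hab.lt l l.2
    have hkl := hab.right k l
    have hl2 := l.2
    fin_cases c <;> fin_cases d <;> simp [s0, s1] at hij ⊢ <;>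
    · rcases eq_or_ne (k : ℕ) l with h | h
      · rw [h] at hk ⊢
        omega
      · have := hkl (by omega) hl2
        omega
  have hsv : ∀ i j, π (s i) < π (s j) ↔ sumOf21 n i < sumOf21 n j := by
    have : StrictMono fun i => π (s ((sumOf21 n).symm i)) := by
      intro i j hij
      obtain ⟨i, rfl⟩ := (sumOf21 n).surjective i
      obtain ⟨j, rfl⟩ := (sumOf21 n).surjective j
      obtain ⟨⟨k, c⟩, rfl⟩ := finProdFinEquiv.surjective i
      obtain ⟨⟨l, d⟩, rfl⟩ := finProdFinEquiv.surjective j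
      simp only [Equiv.symm_apply_apply]
      rw [sumOf21_apply, sumOf21_apply, Fin.lt_def] at hij
      simp only [finProdFinEquiv_apply_val] at hij
      have hk := hab.gt k k.2
      have hl := hab.gt l l.2
      have hkl := hab.above k l
      have hl2 := l.2
      fin_cases c <;> fin_cases d <;> simp [s0, s1] at hij ⊢ <;>
      · rcases eq_or_ne (k : ℕ) l with h | h
        · rw [h] at hk ⊢
          omega
        · have := hkl (by omega) hl2
          omega
    intro i j
    simpa using this.lt_iff_lt (a := sumOf21 n i) (b := sumOf21 n j)
  have hside : (∀ i j, π (s i) < π (m j)) ∨ (∀ i j, π (m j) < π (s i)) ∨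
      (∀ i j, s i < m j) ∨ (∀ i j, m j < s i) := by
    have lift : ∀ P : Fin N → Fin n → Prop, (∀ k < n, ∀ j, P (a k) j ∧ P (b k) j) →
        ∀ i j, P (s i) j := by
      intro P hP i j
      obtain ⟨⟨k, c⟩, rfl⟩ := finProdFinEquiv.surjective i
      have := hP k k.2 j
      fin_cases c
      · simpa [s0] using this.1
      · simpa [s1] using this.2
    rcases side with h | h | h | h
    · exact Or.inl (lift (fun x j => π x < π (m j)) fun k hk j =>
        ⟨h k hk j, (hab.gt k hk).trans (h k hk j)⟩)
    · exact Or.inr (Or.inl (lift (fun x j => π (m j) < π x) fun k hk j =>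
        ⟨(h k hk j).trans (hab.gt k hk), h k hk j⟩))
    · exact Or.inr (Or.inr (Or.inl (lift (fun x j => x < m j) fun k hk j =>
        ⟨(hab.lt k hk).trans (h k hk j), h k hk j⟩)))
    · exact Or.inr (Or.inr (Or.inr (lift (fun x j => m j < x) fun k hk j =>
        ⟨h k hk j, (h k hk j).trans (hab.lt k hk)⟩)))
  have hne : ∀ i j, s i ≠ m j := by
    intro i j h
    rcases hside with h' | h' | h' | h' <;> have := h' i j <;> rw [h] at this <;>
      exact lt_irrefl _ this
  obtain ⟨σ, e, he, hσ⟩ := exists_pattern (k := 3 * n) π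
      ((Finset.univ.image s) ∪ (Finset.univ.image m)) (by
    rw [Finset.card_union_of_disjoint, Finset.card_image_of_injective _ hs.injective,
      Finset.card_image_of_injective _ hm.injective]
    · simp; omega
    · rw [Finset.disjoint_left]
      intro x hx hx'
      simp only [Finset.mem_image, Finset.mem_univ, true_and] at hx hx'
      obtain ⟨i, rfl⟩ := hx
      obtain ⟨j, hj⟩ := hx'
      exact hne i j hj.symm)
  have hs' : ∀ i, ∃ k, e k = s i := fun i => (he _).1 (by simp)
  have hm' : ∀ i, ∃ k, e k = m i := fun i => (he _).1 (by simp)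
  choose s' hs' using hs'
  choose m' hm' using hm'
  have hs'm : StrictMono s' := fun i j h => by
    rw [← e.lt_iff_lt, hs', hs']; exact hs h
  have hm'm : StrictMono m' := fun i j h => by
    rw [← e.lt_iff_lt, hm', hm']; exact hm h
  have key : IsSawtoothWith σ (OrderEmbedding.ofStrictMono s' hs'm)
      (OrderEmbedding.ofStrictMono m' hm'm) := by
    refine ⟨fun i j h => ?_, fun i j => ?_, ?_, fun k => ?_⟩
    · simp only [OrderEmbedding.coe_ofStrictMono] at h
      apply hne i j
      rw [← hs', ← hm', h]
    · simp only [OrderEmbedding.coe_ofStrictMono]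
      rw [← hσ, hs', hs', hsv]
    · simp only [OrderEmbedding.coe_ofStrictMono, Above, Below, RightOf, LeftOf,
        Finset.mem_image, Finset.mem_univ, true_and, forall_exists_index,
        forall_apply_eq_imp_iff, ← hσ, ← e.lt_iff_lt, hs', hm']
      rcases hside with h | h | h | h
      · exact Or.inl fun j i => h i j
      · exact Or.inr (Or.inl fun j i => h i j)
      · exact Or.inr (Or.inr (Or.inl fun j i => h i j))
      · exact Or.inr (Or.inr (Or.inr fun j i => h i j))
    · have hk := hab.lt k k.2
      have hk' := hab.gt k k.2
      have h0 : e (s' (finProdFinEquiv (k, 0))) = a k := (hs' _).trans (s0 k)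
      have h1 : e (s' (finProdFinEquiv (k, 1))) = b k := (hs' _).trans (s1 k)
      have : ∀ j, Slices σ {s' (finProdFinEquiv (k, 0)), s' (finProdFinEquiv (k, 1))} (m' j) ↔
          Slices π {a k, b k} (m j) := by
        intro j
        rw [slices_pair_iff hk hk', slices_pair_iff]
        · simp only [← hσ, ← e.lt_iff_lt, h0, h1, hm']
        · rw [← e.lt_iff_lt, h0, h1]; exact hk
        · rw [← hσ, h0, h1]; exact hk'
      simp only [OrderEmbedding.coe_ofStrictMono, this]
      exact slices k
  refine ⟨σ, ?_, e, hσ⟩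
  rcases mono with h | h
  · refine Or.inl ⟨_, _, key, fun i j hij => ?_⟩
    simp only [OrderEmbedding.coe_ofStrictMono]
    rw [← hσ, hm', hm']; exact h hij
  · refine Or.inr ⟨_, _, key, fun i j hij => ?_⟩
    simp only [OrderEmbedding.coe_ofStrictMono]
    rw [← hσ, hm', hm']; exact h hij

/-- Pins above or below a sum of `21`s, one for each copy, of monotone heights. -/
theorem exists_sawtooth_of_vertical_pins {N n : ℕ} {π : Equiv.Perm (Fin N)} {a b q : ℕ → Fin N}
    (hab : IsSumOf21 π n a b) (hq : ∀ k < n, a k < q k ∧ q k < b k)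
    (side : (∀ k < n, ∀ j < n, π (a k) < π (q j)) ∨ (∀ k < n, ∀ j < n, π (q j) < π (b k)))
    (mono : (∀ i j, i < j → j < n → π (q i) < π (q j)) ∨
      (∀ i j, i < j → j < n → π (q j) < π (q i))) :
    ∃ σ : Equiv.Perm (Fin (3 * n)),
      (IsParallelSawtooth σ ∨ IsWedgeSawtooth σ) ∧ Contains π σ := by
  refine exists_sawtooth_of_slices hab (fun j => q j) ?_ ?_ ?_ ?_
  · intro i j hij
    exact ((hq i i.2).2.trans (hab.right i j hij j.2)).trans (hq j j.2).1
  · rcases side with h | h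
    · exact Or.inl fun k hk j => h k hk j j.2
    · exact Or.inr (Or.inl fun k hk j => h k hk j j.2)
  · intro k
    have hs : ∀ j : Fin n, π (a k) < π (q j) ∨ π (q j) < π (b k) := fun j => by
      rcases side with h | h
      · exact Or.inl (h k k.2 j j.2)
      · exact Or.inr (h k k.2 j j.2)
    refine ⟨k, ?_, fun j hj => ?_⟩
    · beta_reduce
      rw [slices_pair_iff (hab.lt k k.2) (hab.gt k k.2)]
      exact Or.inl ⟨(hq k k.2).1, (hq k k.2).2, hs k⟩
    · beta_reduce at hj
      rw [slices_pair_iff (hab.lt k k.2) (hab.gt k k.2)] at hj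
      have h1 := hs j
      have h2 : a k < q j ∧ q j < b k := by omega
      have h3 := hq j j.2
      rcases lt_trichotomy j k with h | h | h
      · have := hab.right j k h k.2
        omega
      · exact h
      · have := hab.right k j h j.2
        omega
  · rcases mono with h | h
    · exact Or.inl fun i j hij => h i j hij j.2
    · exact Or.inr fun i j hij => h i j hij j.2

/-- Pins to the right or to the left of a sum of `21`s, one for each copy, of monotone
positions. -/
theorem exists_sawtooth_of_horizontal_pins {N n : ℕ} {π : Equiv.Perm (Fin N)} {a b q : ℕ → Fin N}
    (hab : IsSumOf21 π n a b) (hq : ∀ k < n, π (b k) < π (q k) ∧ π (q k) < π (a k))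
    (side : (∀ k < n, ∀ j < n, b k < q j) ∨ (∀ k < n, ∀ j < n, q j < a k))
    (mono : (∀ i j, i < j → j < n → q i < q j) ∨ (∀ i j, i < j → j < n → q j < q i)) :
    ∃ σ : Equiv.Perm (Fin (3 * n)),
      (IsParallelSawtooth σ ∨ IsWedgeSawtooth σ) ∧ Contains π σ := by
  have hinc : ∀ i j, i < j → j < n → π (q i) < π (q j) := fun i j hij hj =>
    ((hq i (hij.trans hj)).2.trans (hab.above i j hij hj)).trans (hq j hj).1
  have huniq : ∀ k : Fin n, ∀ j : Fin n, Slices π {a k, b k} (q j) ↔ j = k := by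
    intro k j
    have hs : b k < q j ∨ q j < a k := by
      rcases side with h | h
      · exact Or.inl (h k k.2 j j.2)
      · exact Or.inr (h k k.2 j j.2)
    rw [slices_pair_iff (hab.lt k k.2) (hab.gt k k.2)]
    constructor
    · intro hj
      have h2 : π (b k) < π (q j) ∧ π (q j) < π (a k) := by omega
      have h3 := hq j j.2
      rcases lt_trichotomy j k with h | h | h
      · have := hab.above j k h k.2
        omega
      · exact h
      · have := hab.above k j h j.2
        omega
    · rintro rfl
      exact Or.inr ⟨(hq j j.2).1, (hq j j.2).2, hs⟩
  rcases mono with h | h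
  · refine exists_sawtooth_of_slices hab (fun j => q j) (fun i j hij => h i j hij j.2) ?_ ?_
      (Or.inl fun i j hij => hinc i j hij j.2)
    · rcases side with h | h
      · exact Or.inr (Or.inr (Or.inl fun k hk j => h k hk j j.2))
      · exact Or.inr (Or.inr (Or.inr fun k hk j => h k hk j j.2))
    · intro k
      simp only [huniq]
      exact ⟨k, rfl, fun _ h => h⟩
  · -- The pins have to be listed by position, hence in the opposite order.
    refine exists_sawtooth_of_slices hab (fun j => q j.rev)
      (fun i j hij => h _ _ (Fin.rev_lt_rev.2 hij) i.rev.2) ?_ ?_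
      (Or.inr fun i j hij => hinc _ _ (Fin.rev_lt_rev.2 hij) i.rev.2)
    · rcases side with h | h
      · exact Or.inr (Or.inr (Or.inl fun k hk j => h k hk _ j.rev.2))
      · exact Or.inr (Or.inr (Or.inr fun k hk j => h k hk _ j.rev.2))
    · intro k
      simp only [huniq]
      exact ⟨k.rev, Fin.rev_rev k, fun _ h => by rw [← h, Fin.rev_rev]⟩

/-! ### Slicing connected sets of a simple permutation -/

/-- In a simple permutation the rectangular hull of a set of at least two points, if it is not
everything, is sliced.  In terms of the inversion graph: some outside point is adjacent to some
points of the set, but not to all. -/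
theorem PermPattern.IsSimple.exists_mixed {N : ℕ} {π : Equiv.Perm (Fin N)} (hπ : IsSimple π)
    (X : Finset (Fin N)) {u v p : Fin N} (hu : u ∈ X) (hv : v ∈ X) (huv : u ≠ v)
    (hp : ∀ x ∈ X, BelowLeft π x p) :
    ∃ r, r ∉ X ∧ (∃ x ∈ X, Form21 π r x) ∧ ∃ x ∈ X, ¬ Form21 π r x := by
  obtain ⟨l, hl, hl'⟩ := X.exists_min_image id ⟨u, hu⟩
  obtain ⟨m, hm, hm'⟩ := X.exists_max_image id ⟨u, hu⟩
  obtain ⟨d, hd, hd'⟩ := X.exists_min_image π ⟨u, hu⟩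
  obtain ⟨t, ht, ht'⟩ := X.exists_max_image π ⟨u, hu⟩
  simp only [id] at hl' hm'
  by_contra hno
  have hno' : ∀ r x y, x ∈ X → y ∈ X → r ∉ X → Form21 π r x → Form21 π r y := by
    intro r x y hx hy hr h
    by_contra h'
    exact hno ⟨r, hr, ⟨x, hx, h⟩, y, hy, h'⟩
  have key : ∀ r, r ∈ Set.Icc l m ↔ π r ∈ Set.Icc (π d) (π t) := by
    intro r
    by_cases hr : r ∈ X
    · simp [hl' r hr, hm' r hr, hd' r hr, ht' r hr]
    have ne : ∀ x ∈ X, r ≠ x ∧ π r ≠ π x := fun x hx =>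
      ⟨fun h => hr (h ▸ hx), fun h => hr (π.injective h ▸ hx)⟩
    have h1 := hno' r l m hl hm hr
    have h2 := hno' r m l hm hl hr
    have h3 := hno' r d t hd ht hr
    have h4 := hno' r t d ht hd hr
    have n1 := ne l hl
    have n2 := ne m hm
    have n3 := ne d hd
    have n4 := ne t ht
    have := hd' l hl
    have := ht' l hl
    have := hd' m hm
    have := ht' m hm
    have := hl' d hd
    have := hm' d hd
    have := hl' t ht
    have := hm' t ht
    simp only [Form21] at h1 h2 h3 h4
    simp only [Set.mem_Icc]
    constructor <;> intro h <;> by_contra h' <;> omega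
  have himage : π '' Set.Icc l m = Set.Icc (π d) (π t) := by
    ext y
    constructor
    · rintro ⟨r, hr, rfl⟩
      exact (key r).1 hr
    · intro hy
      obtain ⟨r, rfl⟩ := π.surjective y
      exact ⟨r, (key r).2 hy, rfl⟩
  rcases hπ.2 (Set.Icc l m) ⟨⟨l, le_rfl, hl' m hm⟩, Set.ordConnected_Icc,
    himage ▸ Set.ordConnected_Icc⟩ with ⟨i, hi⟩ | h
  · have h1 : u ∈ Set.Icc l m := ⟨hl' u hu, hm' u hu⟩
    have h2 : v ∈ Set.Icc l m := ⟨hl' v hv, hm' v hv⟩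
    rw [hi, Set.mem_singleton_iff] at h1 h2
    exact huv (h1.trans h2.symm)
  · have : p ∈ Set.Icc l m := h ▸ Set.mem_univ p
    exact absurd this.2 (not_le.2 (hp m hm).1)

/-- The inversion graph restricted to a set of points; the other points become isolated. -/
def inversionGraphOn {N : ℕ} (π : Equiv.Perm (Fin N)) (V : Set (Fin N)) :
    SimpleGraph (Fin N) where
  Adj x y := Form21 π x y ∧ x ∈ V ∧ y ∈ V
  symm := ⟨fun _ _ h => ⟨h.1.symm, h.2.2, h.2.1⟩⟩
  loopless := ⟨fun x h => (inversionGraph π).loopless.irrefl x h.1⟩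

theorem mem_of_reachable {N : ℕ} {π : Equiv.Perm (Fin N)} {V : Set (Fin N)} {u x : Fin N}
    (hu : u ∈ V) (h : (inversionGraphOn π V).Reachable u x) : x ∈ V := by
  by_contra hx
  obtain ⟨p⟩ := h
  obtain ⟨d, -, -, h2⟩ := p.exists_boundary_dart V hu hx
  exact h2 d.adj.2.2

/-- The component of a point in `V` has an edge that is sliced by a point outside `V`. -/
theorem PermPattern.IsSimple.exists_slicer {N : ℕ} {π : Equiv.Perm (Fin N)} (hπ : IsSimple π)
    {V : Set (Fin N)} {u v p : Fin N} (hu : u ∈ V) (hv : v ∈ V) (huv : Form21 π u v)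
    (hp : ∀ x ∈ V, BelowLeft π x p) :
    ∃ r x y, r ∉ V ∧ (inversionGraphOn π V).Reachable u x ∧
      (inversionGraphOn π V).Reachable u y ∧ Form21 π x y ∧ Form21 π r x ∧ ¬ Form21 π r y := by
  classical
  let H := inversionGraphOn π V
  have huv' : H.Adj u v := ⟨huv, hu, hv⟩
  obtain ⟨r, hr, ⟨x, hx, hrx⟩, y, hy, hry⟩ := hπ.exists_mixed
    (Finset.univ.filter fun x => H.Reachable u x) (u := u) (v := v) (p := p) (by simp)
    (by simpa using huv'.reachable) huv'.ne
    (fun x hx => hp x (mem_of_reachable hu (by simpa using hx)))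
  simp only [Finset.mem_filter, Finset.mem_univ, true_and] at hr hx hy
  have hrV : r ∉ V := fun hrV => hr <| hx.trans
    (SimpleGraph.Adj.reachable (G := H) ⟨hrx.symm, mem_of_reachable hu hx, hrV⟩)
  obtain ⟨q⟩ := hx.symm.trans hy
  obtain ⟨d, hd, h1, h2⟩ := q.exists_boundary_dart {z | Form21 π r z} hrx hry
  have hd' : H.Reachable u d.fst :=
    hx.trans ⟨q.takeUntil _ (q.dart_fst_mem_support_of_mem_darts hd)⟩
  exact ⟨r, d.fst, d.snd, hrV, hd', hd'.trans d.adj.reachable, d.adj.1, h1, h2⟩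

theorem dist_getVert_of_length_eq_dist {V : Type*} {G : SimpleGraph V} {u v : V} (p : G.Walk u v)
    (hp : p.length = G.dist u v) {j : ℕ} (hj : j ≤ p.length) : G.dist u (p.getVert j) = j := by
  have h1 : G.dist u (p.getVert j) ≤ j :=
    (SimpleGraph.dist_le (p.take j)).trans (by simp)
  obtain ⟨q, hq⟩ := (show G.Reachable u (p.getVert j) from ⟨p.take j⟩).exists_walk_length_eq_dist
  have h2 := SimpleGraph.dist_le (q.append (p.drop j))
  simp only [SimpleGraph.Walk.length_append, SimpleGraph.Walk.drop_length] at h2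
  omega

/-- A shortest path: consecutive points are adjacent, no others are. -/
theorem exists_shortest_path {N : ℕ} {π : Equiv.Perm (Fin N)} {V : Set (Fin N)} {u v : Fin N}
    (hu : u ∈ V) (h : (inversionGraphOn π V).Reachable u v) :
    ∃ (d : ℕ) (y : ℕ → Fin N), y 0 = u ∧ y d = v ∧ (∀ i, y i ∈ V) ∧
      IsInducedPath π (d + 1) y := by
  obtain ⟨p, hp⟩ := h.exists_walk_length_eq_dist
  have hV : ∀ i, p.getVert i ∈ V := fun i => mem_of_reachable hu ⟨p.take i⟩
  refine ⟨p.length, p.getVert, p.getVert_zero, p.getVert_length, hV,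
    fun i hi => (p.adj_getVert_succ (by omega)).1, fun i j hij hj => ?_⟩
  have di := dist_getVert_of_length_eq_dist p hp (j := i) (by omega)
  have dj := dist_getVert_of_length_eq_dist p hp (j := j) (by omega)
  refine ⟨fun h => ?_, fun h => ?_⟩
  · rw [h] at di
    omega
  · obtain ⟨q, hq⟩ := (show (inversionGraphOn π V).Reachable u (p.getVert i) from
      ⟨p.take i⟩).exists_walk_length_eq_dist
    have hadj : (inversionGraphOn π V).Adj (p.getVert i) (p.getVert j) := ⟨h, hV i, hV j⟩
    have := SimpleGraph.dist_le (q.concat hadj)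
    rw [SimpleGraph.Walk.length_concat] at this
    omega

/-! ### Extents of points along a sum of `21`s -/

theorem lt_card_filter_range_iff {w : ℕ} {P : ℕ → Prop} [DecidablePred P]
    (hP : ∀ k l, k < l → l < w → P l → P k) {k : ℕ} (hk : k < w) :
    k < ((Finset.range w).filter P).card ↔ P k := by
  constructor
  · intro h
    by_contra hPk
    have : (Finset.range w).filter P ⊆ Finset.range k := by
      intro l hl
      simp only [Finset.mem_filter, Finset.mem_range] at hl ⊢
      by_contra hkl
      rcases (not_lt.1 hkl).eq_or_lt with rfl | h'
      · exact hPk hl.2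
      · exact hPk (hP k l h' hl.1 hl.2)
    have := Finset.card_le_card this
    rw [Finset.card_range] at this
    omega
  · intro hPk
    have : Finset.range (k + 1) ⊆ (Finset.range w).filter P := by
      intro l hl
      simp only [Finset.mem_filter, Finset.mem_range] at hl ⊢
      refine ⟨by omega, ?_⟩
      rcases (Nat.lt_succ_iff.1 hl).eq_or_lt with rfl | h'
      · exact hPk
      · exact hP l k h' hk hPk
    have := Finset.card_le_card this
    rw [Finset.card_range] at this
    omega

/-- The number of copies of `21` that lie entirely below and to the left of `x`. -/
def lo {N : ℕ} (π : Equiv.Perm (Fin N)) (w : ℕ) (a b : ℕ → Fin N) (x : Fin N) : ℕ :=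
  ((Finset.range w).filter fun k => b k < x ∧ π (a k) < π x).card

/-- The number of copies of `21` that do not lie entirely above and to the right of `x`. Thus the
copies of index in the interval `[lo x, hi x)` are those with a point equal or adjacent to `x` in
the inversion graph. -/
def hi {N : ℕ} (π : Equiv.Perm (Fin N)) (w : ℕ) (a b : ℕ → Fin N) (x : Fin N) : ℕ :=
  ((Finset.range w).filter fun k => ¬ (x < a k ∧ π x < π (b k))).card

section

variable {N w : ℕ} {π : Equiv.Perm (Fin N)} {a b : ℕ → Fin N}

theorem hi_le (x : Fin N) : hi π w a b x ≤ w :=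
  (Finset.card_filter_le _ _).trans (by simp)

theorem lo_le (x : Fin N) : lo π w a b x ≤ w :=
  (Finset.card_filter_le _ _).trans (by simp)

theorem IsSumOf21.lt_lo_iff (h : IsSumOf21 π w a b) {k : ℕ} (hk : k < w) {x : Fin N} :
    k < lo π w a b x ↔ b k < x ∧ π (a k) < π x :=
  lt_card_filter_range_iff (P := fun k => b k < x ∧ π (a k) < π x) (fun k l hkl hl hP => by
    have := h.right k l hkl hl
    have := h.above k l hkl hl
    have := h.lt l hl
    have := h.gt l hl
    omega) hk

theorem IsSumOf21.hi_le_iff (h : IsSumOf21 π w a b) {k : ℕ} (hk : k < w) {x : Fin N} :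
    hi π w a b x ≤ k ↔ x < a k ∧ π x < π (b k) := by
  have := lt_card_filter_range_iff (P := fun k => ¬ (x < a k ∧ π x < π (b k)))
    (fun k l hkl hl hP => by
      have := h.right k l hkl hl
      have := h.above k l hkl hl
      have := h.lt k (hkl.trans hl)
      have := h.gt k (hkl.trans hl)
      omega) hk
  rw [← not_lt]
  unfold hi
  rw [this, not_not]

/-- Apart from the first and the last one, the copies of `21` in the extent of `x` lie entirely
to one side of `x`. -/
theorem IsSumOf21.form21_of_interior (h : IsSumOf21 π w a b) {k : ℕ} {x : Fin N}
    (h1 : lo π w a b x < k) (h2 : k + 1 < hi π w a b x) :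
    Form21 π x (a k) ∧ Form21 π x (b k) := by
  have hw := hi_le (π := π) (w := w) (a := a) (b := b) x
  have l1 := (not_congr (h.lt_lo_iff (show lo π w a b x < w by omega) (x := x))).1 (lt_irrefl _)
  have l2 := (not_congr (h.hi_le_iff (show hi π w a b x - 1 < w by omega) (x := x))).1 (by omega)
  have r1 := h.right _ k h1 (by omega)
  have r2 := h.right k (hi π w a b x - 1) (by omega) (by omega)
  have s1 := h.above _ k h1 (by omega)
  have s2 := h.above k (hi π w a b x - 1) (by omega) (by omega)
  have t1 := h.lt k (by omega)
  have t2 := h.gt k (by omega)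
  unfold Form21
  omega

theorem IsSumOf21.not_form21_of_hi_le (h : IsSumOf21 π w a b) {k : ℕ} {x : Fin N} (hk : k < w)
    (hx : hi π w a b x ≤ k) : ¬ Form21 π x (a k) := by
  have h1 := (h.hi_le_iff hk).1 hx
  have h2 := h.gt k hk
  unfold Form21
  omega

theorem IsSumOf21.lo_term (h : IsSumOf21 π w a b) {k : ℕ} (hk : k < w) :
    lo π w a b (a k) = k ∧ lo π w a b (b k) = k := by
  have h1 := h.lt k hk
  have h2 := h.gt k hk
  have key : ∀ x, a k ≤ x → x ≤ b k → π (b k) ≤ π x → π x ≤ π (a k) → lo π w a b x = k := by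
    intro x h3 h4 h5 h6
    have l1 : ¬ k < lo π w a b x := by rw [h.lt_lo_iff hk]; omega
    rcases Nat.eq_zero_or_pos k with rfl | h0
    · omega
    · have : k - 1 < lo π w a b x := by
        rw [h.lt_lo_iff (by omega)]
        have := h.right (k - 1) k (by omega) hk
        have := h.above (k - 1) k (by omega) hk
        omega
      omega
  exact ⟨key _ le_rfl h1.le h2.le le_rfl, key _ h1.le le_rfl le_rfl h2.le⟩

theorem IsSumOf21.hi_term (h : IsSumOf21 π w a b) {k : ℕ} (hk : k < w) :
    hi π w a b (a k) = k + 1 ∧ hi π w a b (b k) = k + 1 := by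
  have h1 := h.lt k hk
  have h2 := h.gt k hk
  have key : ∀ x, a k ≤ x → x ≤ b k → π (b k) ≤ π x → π x ≤ π (a k) →
      hi π w a b x = k + 1 := by
    intro x h3 h4 h5 h6
    have l1 : ¬ hi π w a b x ≤ k := by rw [h.hi_le_iff hk]; omega
    have l3 := hi_le (π := π) (w := w) (a := a) (b := b) x
    by_cases h0 : k + 1 < w
    · have : hi π w a b x ≤ k + 1 := by
        rw [h.hi_le_iff h0]
        have := h.right k (k + 1) (by omega) h0
        have := h.above k (k + 1) (by omega) h0
        omega
      omega
    · omega
  exact ⟨key _ le_rfl h1.le h2.le le_rfl, key _ h1.le le_rfl le_rfl h2.le⟩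

theorem IsSumOf21.lo_le_hi_of_form21 (h : IsSumOf21 π w a b) {x y : Fin N} (hxy : Form21 π x y) :
    lo π w a b x ≤ hi π w a b y := by
  by_contra hlt
  have hw := lo_le (π := π) (w := w) (a := a) (b := b) x
  have h1 := (h.lt_lo_iff (show hi π w a b y < w by omega) (x := x)).1 (by omega)
  have h2 := (h.hi_le_iff (show hi π w a b y < w by omega) (x := y)).1 le_rfl
  have h3 := h.lt (hi π w a b y) (by omega)
  have h4 := h.gt (hi π w a b y) (by omega)
  unfold Form21 at hxy
  omega

theorem IsSumOf21.lo_le_of_form21 (h : IsSumOf21 π w a b) {k : ℕ} {x : Fin N} (hk : k < w)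
    (hx : Form21 π (a k) x) : lo π w a b x ≤ k ∧ k < hi π w a b x := by
  have h1 := h.lt k hk
  have h2 := h.gt k hk
  unfold Form21 at hx
  refine ⟨not_lt.1 ?_, not_le.1 ?_⟩
  · rw [h.lt_lo_iff hk]
    omega
  · rw [h.hi_le_iff hk]
    omega

end

/-! ### Pins that pass a long stretch of the sum -/

/-- The point `q` slices the copy `u, v` of `21` from the side `d`, where `(true, true)` stands
for up, `(true, false)` for down, `(false, true)` for right and `(false, false)` for left. -/
def PinOn {N : ℕ} (π : Equiv.Perm (Fin N)) (d : Bool × Bool) (u v q : Fin N) : Prop :=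
  match d with
  | (true, true) => u < q ∧ q < v ∧ π u < π q
  | (true, false) => u < q ∧ q < v ∧ π q < π v
  | (false, true) => π v < π q ∧ π q < π u ∧ v < q
  | (false, false) => π v < π q ∧ π q < π u ∧ q < u

/-- The point `x` is passed by the pin `q` of the copy `u, v` of `21`: it is further than `u` and
`v`, but not than `q`, in the direction `d`, and comparable with `u` and `v`. -/
def Passes {N : ℕ} (π : Equiv.Perm (Fin N)) (d : Bool × Bool) (u v q x : Fin N) : Prop :=
  match d with
  | (true, true) => v < x ∧ π u < π x ∧ π x < π q
  | (true, false) => x < u ∧ π x < π v ∧ π q < π x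
  | (false, true) => v < x ∧ π u < π x ∧ x < q
  | (false, false) => x < u ∧ π x < π v ∧ q < x

/-- A pin of a copy of `21` that passes `s` consecutive copies of `21` in the sum. The copy that
is sliced lies between the first and the last terms of the sum. -/
structure IsLongPin {N : ℕ} (π : Equiv.Perm (Fin N)) (w : ℕ) (a b : ℕ → Fin N) (s c : ℕ)
    (d : Bool × Bool) (u v q : Fin N) : Prop where
  le : c + s ≤ w
  lt : u < v
  gt : π v < π u
  right_first : b 0 < u
  above_first : π (a 0) < π v
  left_last : v < a (w - 1)
  below_last : π u < π (b (w - 1))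
  pin : PinOn π d u v q
  passes : ∀ k, c ≤ k → k < c + s → Passes π d u v q (a k) ∧ Passes π d u v q (b k)

section

variable {N w : ℕ} {π : Equiv.Perm (Fin N)} {a b : ℕ → Fin N}

/-- A point adjacent to exactly one end of an edge is a pin for it, and if its extent reaches far
beyond the extent of the edge, then it is a long pin. -/
theorem IsSumOf21.exists_isLongPin (h : IsSumOf21 π w a b) {s c : ℕ} (hs : 0 < s)
    (hc : c + s ≤ w) {u v q : Fin N} (huv : u < v) (hvu : π v < π u) (hqu : q ≠ u) (hqv : q ≠ v)
    (hq : Form21 π q u ∧ ¬ Form21 π q v ∨ Form21 π q v ∧ ¬ Form21 π q u)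
    (hfull : ∀ k, c ≤ k → k < c + s → Form21 π q (a k) ∧ Form21 π q (b k))
    (hside : (∀ k, c ≤ k → k < c + s → v < a k ∧ π u < π (b k)) ∨
      (∀ k, c ≤ k → k < c + s → b k < u ∧ π (a k) < π v))
    (hu0 : b 0 < u) (hv0 : π (a 0) < π v) (hv1 : v < a (w - 1)) (hu1 : π u < π (b (w - 1))) :
    ∃ d, IsLongPin π w a b s c d u v q := by
  have e1 : π q ≠ π u := fun h => hqu (π.injective h)
  have e2 : π q ≠ π v := fun h => hqv (π.injective h)
  have hpin : PinOn π (true, true) u v q ∨ PinOn π (true, false) u v q ∨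
      PinOn π (false, true) u v q ∨ PinOn π (false, false) u v q := by
    simp only [PinOn]
    unfold Form21 at hq
    omega
  have hcs : c < c + s := by omega
  have hc1 := h.lt c (by omega)
  have hc2 := h.gt c (by omega)
  have fc := hfull c le_rfl hcs
  have lift : ∀ d, PinOn π d u v q → (∀ k, c ≤ k → k < c + s →
      Passes π d u v q (a k) ∧ Passes π d u v q (b k)) → ∃ d, IsLongPin π w a b s c d u v q :=
    fun d hp hpass => ⟨d, hc, huv, hvu, hu0, hv0, hv1, hu1, hp, hpass⟩
  simp only [Form21] at hfull fc
  rcases hside with hside | hside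
  · have sc := hside c le_rfl hcs
    rcases hpin with hp | hp | hp | hp
    · refine lift _ hp fun k hk hk' => ?_
      have h1 := hfull k hk hk'
      have h2 := hside k hk hk'
      have h3 := h.lt k (by omega)
      have h4 := h.gt k (by omega)
      simp only [PinOn, Passes] at hp ⊢
      omega
    · simp only [PinOn] at hp
      omega
    · refine lift _ hp fun k hk hk' => ?_
      have h1 := hfull k hk hk'
      have h2 := hside k hk hk'
      have h3 := h.lt k (by omega)
      have h4 := h.gt k (by omega)
      simp only [PinOn, Passes] at hp ⊢
      omega
    · simp only [PinOn] at hp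
      omega
  · have sc := hside c le_rfl hcs
    rcases hpin with hp | hp | hp | hp
    · simp only [PinOn] at hp
      omega
    · refine lift _ hp fun k hk hk' => ?_
      have h1 := hfull k hk hk'
      have h2 := hside k hk hk'
      have h3 := h.lt k (by omega)
      have h4 := h.gt k (by omega)
      simp only [PinOn, Passes] at hp ⊢
      omega
    · simp only [PinOn] at hp
      omega
    · refine lift _ hp fun k hk hk' => ?_
      have h1 := hfull k hk hk'
      have h2 := hside k hk hk'
      have h3 := h.lt k (by omega)
      have h4 := h.gt k (by omega)
      simp only [PinOn, Passes] at hp ⊢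
      omega

/-- If there are no long pins, then the extent of a point that slices an edge exceeds the extent
of the edge by a bounded amount. -/
theorem IsSumOf21.extent_le (h : IsSumOf21 π w a b) {s : ℕ} (hs : 0 < s)
    (hno : ¬ ∃ c d u v q, IsLongPin π w a b s c d u v q) {x y q : Fin N} (hxy : Form21 π x y)
    (hqx : Form21 π q x) (hqy : ¬ Form21 π q y) (hne : q ≠ y)
    (hx0 : 0 < lo π w a b x) (hy0 : 0 < lo π w a b y)
    (hx1 : hi π w a b x < w) (hy1 : hi π w a b y < w) :
    hi π w a b q ≤ max (hi π w a b x) (hi π w a b y) + (s + 3) ∧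
      min (lo π w a b x) (lo π w a b y) ≤ lo π w a b q + (s + 3) := by
  have hqx' : q ≠ x := fun h => (inversionGraph π).loopless.irrefl x (h ▸ hqx)
  -- Any `s` interior copies in the extent of `q` beyond the edge make `q` a long pin.
  have main : ∀ c, c + s ≤ w →
      (∀ k, c ≤ k → k < c + s → lo π w a b q < k ∧ k + 1 < hi π w a b q) →
      ((∀ k, c ≤ k → k < c + s → hi π w a b x ≤ k ∧ hi π w a b y ≤ k) ∨
        (∀ k, c ≤ k → k < c + s → k < lo π w a b x ∧ k < lo π w a b y)) → False := by
    intro c hc hint hside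
    have x0 := (h.lt_lo_iff (by omega)).1 hx0
    have y0 := (h.lt_lo_iff (by omega)).1 hy0
    have x1 := (h.hi_le_iff (by omega)).1 (Nat.le_sub_one_of_lt hx1)
    have y1 := (h.hi_le_iff (by omega)).1 (Nat.le_sub_one_of_lt hy1)
    have hfull : ∀ k, c ≤ k → k < c + s → Form21 π q (a k) ∧ Form21 π q (b k) := fun k hk hk' =>
      h.form21_of_interior (hint k hk hk').1 (hint k hk hk').2
    have hside' : (∀ k, c ≤ k → k < c + s →
          (x < a k ∧ π x < π (b k)) ∧ (y < a k ∧ π y < π (b k))) ∨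
        (∀ k, c ≤ k → k < c + s → (b k < x ∧ π (a k) < π x) ∧ (b k < y ∧ π (a k) < π y)) := by
      refine hside.imp (fun hs k hk hk' => ?_) (fun hs k hk hk' => ?_)
      · exact ⟨(h.hi_le_iff (by omega)).1 (hs k hk hk').1,
          (h.hi_le_iff (by omega)).1 (hs k hk hk').2⟩
      · exact ⟨(h.lt_lo_iff (by omega)).1 (hs k hk hk').1,
          (h.lt_lo_iff (by omega)).1 (hs k hk hk').2⟩
    rcases hxy with ⟨h1, h2⟩ | ⟨h1, h2⟩
    · obtain ⟨d, hd⟩ := h.exists_isLongPin hs hc h1 h2 hqx' hne (Or.inl ⟨hqx, hqy⟩) hfull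
        (hside'.imp (fun hs k hk hk' => ⟨(hs k hk hk').2.1, (hs k hk hk').1.2⟩)
          (fun hs k hk hk' => ⟨(hs k hk hk').1.1, (hs k hk hk').2.2⟩))
        x0.1 y0.2 y1.1 x1.2
      exact hno ⟨c, d, x, y, q, hd⟩
    · obtain ⟨d, hd⟩ := h.exists_isLongPin hs hc h1 h2 hne hqx' (Or.inr ⟨hqx, hqy⟩) hfull
        (hside'.imp (fun hs k hk hk' => ⟨(hs k hk hk').1.1, (hs k hk hk').2.2⟩)
          (fun hs k hk hk' => ⟨(hs k hk hk').2.1, (hs k hk hk').1.2⟩))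
        y0.1 x0.2 x1.1 y1.2
      exact hno ⟨c, d, y, x, q, hd⟩
  have l1 := h.lo_le_hi_of_form21 hqx
  have l2 := h.lo_le_hi_of_form21 hqx.symm
  have l3 := hi_le (π := π) (w := w) (a := a) (b := b) q
  constructor
  · by_contra hlt
    refine main (max (hi π w a b x) (hi π w a b y) + 1) (by omega) (fun k hk hk' => by omega)
      (Or.inl fun k hk hk' => by omega)
  · by_contra hlt
    refine main (lo π w a b q + 1) (by omega) (fun k hk hk' => by omega)
      (Or.inr fun k hk hk' => by omega)

/-- Extents are laminar, up to a bounded error, if there are no long pins. -/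
theorem IsSumOf21.not_crossing (h : IsSumOf21 π w a b) {s : ℕ} (hs : 0 < s)
    (hno : ¬ ∃ c d u v q, IsLongPin π w a b s c d u v q) {y z : Fin N}
    (hz0 : 0 < lo π w a b z) (hz1 : hi π w a b z < w)
    (h1 : lo π w a b y + (s + 3) < lo π w a b z) (h2 : lo π w a b z + 2 < hi π w a b y)
    (h3 : hi π w a b y + 1 < hi π w a b z) : False := by
  by_cases hyz : Form21 π y z
  · -- A copy of `21` beyond the extent of `y` yields an edge at `z` that `y` slices.
    have hj : hi π w a b y < w := by omega
    have e1 := h.lo_term hj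
    have e2 := h.hi_term hj
    have := h.extent_le hs hno (x := z) (y := a (hi π w a b y)) (q := y)
      (h.form21_of_interior (by omega) (by omega)).1 hyz (h.not_form21_of_hi_le hj le_rfl)
      (fun e => by rw [← e] at e2; omega) hz0 (by omega) hz1 (by omega)
    omega
  · -- A copy of `21` in both extents yields an edge at `z` that `y` slices.
    have hk : lo π w a b z + 1 < w := by omega
    have e1 := h.lo_term hk
    have e2 := h.hi_term hk
    have := h.extent_le hs hno (x := a (lo π w a b z + 1)) (y := z) (q := y)
      (h.form21_of_interior (by omega) (by omega)).1.symm
      (h.form21_of_interior (by omega) (by omega)).1 hyz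
      (fun e => by rw [e] at h1; omega) (by omega) hz0 (by omega) hz1
    omega

/-- If there are no long pins and no long induced paths, then every term of the sum is in the
extent of a point, whose extent is contained in a prescribed interval and nearly reaches one of
its ends. -/
theorem IsSumOf21.exists_extent (h : IsSumOf21 π w a b) (hπ : IsSimple π) {s n : ℕ} (hs : 0 < s)
    (hno : ¬ ∃ c d u v q, IsLongPin π w a b s c d u v q) (hpath : ¬ ∃ y, IsInducedPath π n y)
    {A B i : ℕ} (hA : 0 < A) (hAi : A ≤ i) (hiB : i < B) (hB : B < w) :
    ∃ y, A ≤ lo π w a b y ∧ lo π w a b y ≤ i ∧ i < hi π w a b y ∧ hi π w a b y ≤ B ∧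
      (B ≤ hi π w a b y + (n + 1) * (s + 3) ∨ lo π w a b y ≤ A + (n + 1) * (s + 3)) := by
  let V : Set (Fin N) := {x | A ≤ lo π w a b x ∧ hi π w a b x ≤ B}
  have hiw : i < w := by omega
  have la := h.lo_term hiw
  have ha := h.hi_term hiw
  have haV : a i ∈ V := ⟨by omega, by omega⟩
  have hbV : b i ∈ V := ⟨by omega, by omega⟩
  obtain ⟨r, x, y, hr, hx, hy, hxy, hrx, hry⟩ := hπ.exists_slicer (p := a (w - 1)) haV hbV
    (Or.inl ⟨h.lt i hiw, h.gt i hiw⟩) (fun x hx => by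
      have := (h.hi_le_iff (show w - 1 < w by omega) (x := x)).1 (by have := hx.2; omega)
      exact ⟨this.1, this.2.trans (h.gt _ (by omega))⟩)
  have hxV : x ∈ V := mem_of_reachable haV hx
  have hyV : y ∈ V := mem_of_reachable haV hy
  have hxV1 := hxV.1
  have hxV2 := hxV.2
  have hyV1 := hyV.1
  have hyV2 := hyV.2
  have hrext := h.extent_le hs hno hxy hrx hry (fun e => hr (e ▸ hyV)) (by omega) (by omega)
    (by omega) (by omega)
  -- Some point of the component has an extent that nearly leaves the interval.
  obtain ⟨v, hv, hvext⟩ : ∃ v, (inversionGraphOn π V).Reachable (a i) v ∧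
      (B ≤ hi π w a b v + (s + 3) ∨ lo π w a b v ≤ A + (s + 3)) := by
    have hr' : lo π w a b r < A ∨ B < hi π w a b r := by
      by_contra hcon
      exact hr ⟨by omega, by omega⟩
    by_cases hx' : B ≤ hi π w a b x + (s + 3) ∨ lo π w a b x ≤ A + (s + 3)
    · exact ⟨x, hx, hx'⟩
    · exact ⟨y, hy, by omega⟩
  obtain ⟨d, p, p0, pd, hpV, hpp⟩ := exists_shortest_path haV hv
  have hdn : d < n := by
    by_contra hdn
    exact hpath ⟨p, fun j hj => hpp.1 j (by omega), fun j k hjk hk => hpp.2 j k hjk (by omega)⟩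
  rcases Nat.eq_zero_or_pos d with rfl | hd
  · have : v = a i := by rw [← pd, p0]
    subst this
    refine ⟨a i, by omega, by omega, by omega, by omega, ?_⟩
    have : s + 3 ≤ (n + 1) * (s + 3) := Nat.le_mul_of_pos_left _ (by omega)
    omega
  -- The second point of the path has an extent that is nearly as long.
  have h01 := hpp.1 0 (by omega)
  rw [p0, zero_add] at h01
  have h1 := h.lo_le_of_form21 hiw h01
  have step : ∀ j, (j ≤ d → hi π w a b (p j) ≤ hi π w a b (p 1) + j * (s + 3) ∧
      lo π w a b (p 1) ≤ lo π w a b (p j) + j * (s + 3)) ∧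
      (j + 1 ≤ d → hi π w a b (p (j + 1)) ≤ hi π w a b (p 1) + (j + 1) * (s + 3) ∧
      lo π w a b (p 1) ≤ lo π w a b (p (j + 1)) + (j + 1) * (s + 3)) := by
    intro j
    induction j with
    | zero =>
      refine ⟨fun _ => ?_, fun _ => ?_⟩
      · rw [p0]
        omega
      · simp only [zero_add]
        omega
    | succ j ih =>
      refine ⟨ih.2, fun hj => ?_⟩
      have i1 := ih.1 (by omega)
      have i2 := ih.2 (by omega)
      have v1 := hpV j
      have v2 := hpV (j + 1)
      have v11 := v1.1
      have v12 := v1.2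
      have v21 := v2.1
      have v22 := v2.2
      have e1 := hpp.1 j (by omega)
      have e2 := hpp.1 (j + 1) (by omega)
      have e3 := hpp.2 j (j + 1 + 1) (by omega) (by omega)
      have := h.extent_le hs hno e1.symm e2.symm (fun e => e3.2 e.symm) e3.1.symm
        (by omega) (by omega) (by omega) (by omega)
      have m1 : (j + 1) * (s + 3) = j * (s + 3) + (s + 3) := by ring
      have m2 : (j + 1 + 1) * (s + 3) = (j + 1) * (s + 3) + (s + 3) := by ring
      omega
  have hlast := (step d).1 le_rfl
  rw [pd] at hlast
  have v1 := hpV 1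
  have hv1 := v1.1
  have hv2 := v1.2
  refine ⟨p 1, hv1, h1.1, h1.2, hv2, ?_⟩
  have m1 : d * (s + 3) ≤ n * (s + 3) := Nat.mul_le_mul_right _ hdn.le
  have m2 : (n + 1) * (s + 3) = n * (s + 3) + (s + 3) := by ring
  omega

/-- A long sum of `21`s in a simple permutation has a long pin, or there is a long induced path in
the inversion graph. -/
theorem IsSumOf21.exists_longPin (h : IsSumOf21 π w a b) (hπ : IsSimple π) {s n : ℕ} (hs : 0 < s)
    (hpath : ¬ ∃ y, IsInducedPath π n y) (hw : 40 * ((n + 1) * (s + 3)) ≤ w) :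
    ∃ c d u v q, IsLongPin π w a b s c d u v q := by
  by_contra hno
  have hM : s + 3 ≤ (n + 1) * (s + 3) := Nat.le_mul_of_pos_left _ (by omega)
  have ext := fun A B i => h.exists_extent hπ hs hno hpath (A := A) (B := B) (i := i)
  have lam := fun y z => h.not_crossing hs hno (y := y) (z := z)
  generalize (n + 1) * (s + 3) = M at *
  -- Two disjoint extents `y₁`, `y₂` of moderate length, far apart.
  obtain ⟨y₁, a1, a2, a3, a4, a5⟩ := ext (5 * M) (15 * M) (10 * M) (by omega) (by omega) (by omega)
    (by omega)
  obtain ⟨y₂, b1, b2, b3, b4, b5⟩ := ext (25 * M) (35 * M) (30 * M) (by omega) (by omega)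
    (by omega) (by omega)
  -- An extent that starts at the right end of `y₁` must reach the right end of the sum.
  obtain ⟨z₁, c1, c2, c3, c4, c5⟩ := ext (hi π w a b y₁ - 2 * M) (w - 1) (hi π w a b y₁ + 1)
    (by omega) (by omega) (by omega) (by omega)
  have k1 := lam y₁ z₁ (by omega) (by omega) (by omega)
  -- An extent that ends at the left end of `y₂` must reach the left end of the sum.
  obtain ⟨z₂, d1, d2, d3, d4, d5⟩ := ext 1 (lo π w a b y₂ + 2 * M) (lo π w a b y₂ - (s + 3) - 1)
    (by omega) (by omega) (by omega) (by omega)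
  have k2 := lam z₂ y₂ (by omega) (by omega) (by omega)
  have k1' : ¬ (lo π w a b z₁ + 2 < hi π w a b y₁) := fun hk => k1 hk (by omega)
  have k2' : ¬ (lo π w a b y₂ + 2 < hi π w a b z₂) := fun hk => k2 hk (by omega)
  -- Hence these two extents cross.
  exact lam z₂ z₁ (by omega) (by omega) (by omega) (by omega) (by omega)

end

/-! ### Nested pins -/

/-- A finite Erdős–Szekeres theorem, with an exponential bound: among `2 ^ (p + q)` terms there is
an increasing subsequence of length `p` or a decreasing one of length `q`. -/
theorem exists_monotone_subsequence {α : Type*} [LinearOrder α] (f : ℕ → α) (k : ℕ) :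
    ∀ (p q : ℕ) (A : Finset ℕ), p + q = k → Set.InjOn f A → 2 ^ k ≤ A.card →
      (∃ g : ℕ → ℕ, (∀ i < p, g i ∈ A) ∧
        ∀ i j, i < j → j < p → g i < g j ∧ f (g i) < f (g j)) ∨
      (∃ g : ℕ → ℕ, (∀ i < q, g i ∈ A) ∧
        ∀ i j, i < j → j < q → g i < g j ∧ f (g j) < f (g i)) := by
  -- A first term can be put in front of any sequence of later terms related to it.
  have cons : ∀ (R : α → α → Prop) (p : ℕ) (A : Finset ℕ) (m : ℕ) (g : ℕ → ℕ), m ∈ A →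
      (∀ i < p, g i ∈ A ∧ m < g i ∧ R (f m) (f (g i))) →
      (∀ i j, i < j → j < p → g i < g j ∧ R (f (g i)) (f (g j))) →
      ∃ g : ℕ → ℕ, (∀ i < p + 1, g i ∈ A) ∧
        ∀ i j, i < j → j < p + 1 → g i < g j ∧ R (f (g i)) (f (g j)) := by
    intro R p A m g hm hg hg'
    refine ⟨fun i => Nat.casesOn i m g, fun i hi => ?_, fun i j hij hj => ?_⟩
    · cases i with
      | zero => exact hm
      | succ i => exact (hg i (by omega)).1
    · cases j with
      | zero => omega
      | succ j =>
        cases i with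
        | zero => exact (hg j (by omega)).2
        | succ i => exact hg' i j (by omega) (by omega)
  induction k with
  | zero =>
    intro p q A hpq _ _
    exact Or.inl ⟨id, fun i hi => by omega, fun i j _ hj => by omega⟩
  | succ k ih =>
    intro p q A hpq hf hA
    rcases Nat.eq_zero_or_pos p with rfl | hp
    · exact Or.inl ⟨id, fun i hi => by omega, fun i j _ hj => by omega⟩
    rcases Nat.eq_zero_or_pos q with rfl | hq
    · exact Or.inr ⟨id, fun i hi => by omega, fun i j _ hj => by omega⟩
    have hne : A.Nonempty := by
      rw [← Finset.card_pos]
      exact lt_of_lt_of_le (by positivity) hA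
    obtain ⟨m, hm, hmin⟩ := A.exists_min_image id hne
    have hlt : ∀ i ∈ A.erase m, i ∈ A ∧ m < i ∧ f m ≠ f i := fun i hi => by
      rw [Finset.mem_erase] at hi
      exact ⟨hi.2, lt_of_le_of_ne (hmin i hi.2) (Ne.symm hi.1),
        fun h => hi.1 (hf hm hi.2 h).symm⟩
    have hcard := Finset.card_filter_add_card_filter_not (s := A.erase m) (fun i => f m < f i)
    rw [Finset.card_erase_of_mem hm] at hcard
    have hpow : 2 ^ (k + 1) = 2 ^ k + 2 ^ k := by ring
    by_cases hbig : 2 ^ k ≤ ((A.erase m).filter fun i => f m < f i).card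
    · have hsub : ∀ i ∈ (A.erase m).filter (fun i => f m < f i), i ∈ A ∧ m < i ∧ f m < f i :=
        fun i hi => by
          rw [Finset.mem_filter] at hi
          exact ⟨(hlt i hi.1).1, (hlt i hi.1).2.1, hi.2⟩
      rcases ih (p - 1) q _ (by omega) (hf.mono fun i hi => (hsub i hi).1) hbig with
        ⟨g, hg, hg'⟩ | ⟨g, hg, hg'⟩
      · left
        have := cons (· < ·) (p - 1) A m g hm (fun i hi => hsub _ (hg i hi)) hg'
        rwa [Nat.sub_add_cancel hp] at this
      · exact Or.inr ⟨g, fun i hi => (hsub _ (hg i hi)).1, hg'⟩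
    · have hsub : ∀ i ∈ (A.erase m).filter (fun i => ¬ f m < f i), i ∈ A ∧ m < i ∧ f i < f m :=
        fun i hi => by
          rw [Finset.mem_filter] at hi
          exact ⟨(hlt i hi.1).1, (hlt i hi.1).2.1,
            lt_of_le_of_ne (not_lt.1 hi.2) (hlt i hi.1).2.2.symm⟩
      rcases ih p (q - 1) _ (by omega) (hf.mono fun i hi => (hsub i hi).1) (by omega) with
        ⟨g, hg, hg'⟩ | ⟨g, hg, hg'⟩
      · exact Or.inl ⟨g, fun i hi => (hsub _ (hg i hi)).1, hg'⟩
      · right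
        have := cons (fun x y => y < x) (q - 1) A m g hm (fun i hi => hsub _ (hg i hi)) hg'
        rwa [Nat.sub_add_cancel hq] at this

/-- Pins `q i` of copies `u i, v i` of `21`, for `i < r`, such that every pin passes all the later
copies. -/
structure IsPinFamily {N : ℕ} (π : Equiv.Perm (Fin N)) (r : ℕ) (d : ℕ → Bool × Bool)
    (u v q : ℕ → Fin N) : Prop where
  lt : ∀ i, i < r → u i < v i
  gt : ∀ i, i < r → π (v i) < π (u i)
  pin : ∀ i, i < r → PinOn π (d i) (u i) (v i) (q i)
  passes : ∀ i j, i < j → j < r → Passes π (d i) (u i) (v i) (q i) (u j) ∧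
    Passes π (d i) (u i) (v i) (q i) (v j)

/-- A length of a sum of `21`s that guarantees a family of `r` nested pins. -/
def nestedPinsBound (n : ℕ) : ℕ → ℕ
  | 0 => 1
  | r + 1 => 40 * ((n + 1) * (nestedPinsBound n r + 3))

theorem nestedPinsBound_pos (n r : ℕ) : 0 < nestedPinsBound n r := by
  cases r <;> simp [nestedPinsBound]

/-- Long pins are found again and again, each inside the stretch passed by the one before. -/
theorem exists_isPinFamily {N n : ℕ} {π : Equiv.Perm (Fin N)} (hπ : IsSimple π)
    (hpath : ¬ ∃ y, IsInducedPath π n y) (r : ℕ) :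
    ∀ {a b : ℕ → Fin N}, IsSumOf21 π (nestedPinsBound n r) a b → ∃ d u v q,
      IsPinFamily π r d u v q ∧ ∀ i < r, b 0 < u i ∧ π (a 0) < π (v i) ∧
        v i < a (nestedPinsBound n r - 1) ∧ π (u i) < π (b (nestedPinsBound n r - 1)) := by
  induction r with
  | zero =>
    intro a b _
    exact ⟨fun _ => (true, true), a, a, a, ⟨fun i hi => by omega, fun i hi => by omega,
      fun i hi => by omega, fun i j _ hj => by omega⟩, fun i hi => by omega⟩
  | succ r ih =>
    intro a b hab
    have hpos := nestedPinsBound_pos n r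
    obtain ⟨c, d₀, u₀, v₀, q₀, hlong⟩ := hab.exists_longPin hπ hpos hpath le_rfl
    have hc := hlong.le
    have hsub : IsSumOf21 π (nestedPinsBound n r) (a ∘ (c + ·)) (b ∘ (c + ·)) :=
      hab.comp (fun i j hij _ => by omega) (fun i hi => by omega)
    obtain ⟨d, u, v, q, hfam, hbox⟩ := ih hsub
    simp only [Function.comp_apply, add_zero] at hbox
    generalize nestedPinsBound n r = s at *
    generalize nestedPinsBound n (r + 1) = w at *
    have first := hlong.passes c le_rfl (by omega)
    have last := hlong.passes (c + (s - 1)) (by omega) (by omega)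
    have t1 := hab.lt c (by omega)
    have t2 := hab.gt c (by omega)
    have t3 := hab.lt (c + (s - 1)) (by omega)
    have t4 := hab.gt (c + (s - 1)) (by omega)
    have hpass : ∀ i < r, Passes π d₀ u₀ v₀ q₀ (u i) ∧ Passes π d₀ u₀ v₀ q₀ (v i) := by
      intro i hi
      have h1 := hbox i hi
      have h2 := hfam.lt i hi
      have h3 := hfam.gt i hi
      obtain ⟨_ | _, _ | _⟩ := d₀ <;> simp only [Passes] at first last ⊢ <;> omega
    have hbox' : ∀ i < r, b 0 < u i ∧ π (a 0) < π (v i) ∧ v i < a (w - 1) ∧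
        π (u i) < π (b (w - 1)) := by
      intro i hi
      have h1 := hbox i hi
      have h2 : b 0 ≤ b c ∧ π (a 0) ≤ π (a c) := by
        rcases Nat.eq_zero_or_pos c with h0 | h0
        · rw [h0]
          exact ⟨le_rfl, le_rfl⟩
        · have := hab.right 0 c h0 (by omega)
          have := hab.above 0 c h0 (by omega)
          omega
      have h3 : a (c + (s - 1)) ≤ a (w - 1) ∧ π (b (c + (s - 1))) ≤ π (b (w - 1)) := by
        rcases Nat.eq_or_lt_of_le (show c + (s - 1) ≤ w - 1 by omega) with h0 | h0
        · rw [h0]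
          exact ⟨le_rfl, le_rfl⟩
        · have := hab.right _ _ h0 (by omega)
          have := hab.above _ _ h0 (by omega)
          omega
      omega
    refine ⟨fun i => Nat.casesOn i d₀ d, fun i => Nat.casesOn i u₀ u, fun i => Nat.casesOn i v₀ v,
      fun i => Nat.casesOn i q₀ q, ⟨?_, ?_, ?_, ?_⟩, ?_⟩
    · rintro (_ | i) hi
      exacts [hlong.lt, hfam.lt i (by omega)]
    · rintro (_ | i) hi
      exacts [hlong.gt, hfam.gt i (by omega)]
    · rintro (_ | i) hi
      exacts [hlong.pin, hfam.pin i (by omega)]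
    · rintro (_ | i) (_ | j) hij hj
      · omega
      · exact hpass j (by omega)
      · omega
      · exact hfam.passes i j (by omega) (by omega)
    · rintro (_ | i) hi
      exacts [⟨hlong.right_first, hlong.above_first, hlong.left_last, hlong.below_last⟩,
        hbox' i (by omega)]

theorem IsPinFamily.comp {N r n : ℕ} {π : Equiv.Perm (Fin N)} {d : ℕ → Bool × Bool}
    {u v q : ℕ → Fin N} (h : IsPinFamily π r d u v q) {g : ℕ → ℕ}
    (hg : ∀ i j, i < j → j < n → g i < g j) (hr : ∀ i < n, g i < r) :
    IsPinFamily π n (d ∘ g) (u ∘ g) (v ∘ g) (q ∘ g) :=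
  ⟨fun i hi => h.lt _ (hr i hi), fun i hi => h.gt _ (hr i hi), fun i hi => h.pin _ (hr i hi),
    fun i j hij hj => h.passes _ _ (hg i j hij hj) (hr j hj)⟩

/-- The coordinate of a pin along the direction in which it leaves the copy it slices. -/
def pinHeight {N : ℕ} (π : Equiv.Perm (Fin N)) (vertical : Bool) (q : Fin N) : Fin N :=
  if vertical then π q else q

theorem pinHeight_injective {N : ℕ} (π : Equiv.Perm (Fin N)) (vertical : Bool) :
    Function.Injective (pinHeight π vertical) := by
  intro x y h
  cases vertical
  · exact h
  · exact π.injective h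

/-- Pins with a common direction and monotone heights form a sawtooth alternation. -/
theorem IsPinFamily.exists_sawtooth {N n : ℕ} {π : Equiv.Perm (Fin N)} {d : ℕ → Bool × Bool}
    {d₀ : Bool × Bool} {u v q : ℕ → Fin N} (h : IsPinFamily π n d u v q)
    (hd : ∀ i < n, d i = d₀)
    (mono : (∀ i j, i < j → j < n → pinHeight π d₀.1 (q i) < pinHeight π d₀.1 (q j)) ∨
      (∀ i j, i < j → j < n → pinHeight π d₀.1 (q j) < pinHeight π d₀.1 (q i))) :
    ∃ σ : Equiv.Perm (Fin (3 * n)),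
      (IsParallelSawtooth σ ∨ IsWedgeSawtooth σ) ∧ Contains π σ := by
  have pin : ∀ i < n, PinOn π d₀ (u i) (v i) (q i) := fun i hi => hd i hi ▸ h.pin i hi
  have passes : ∀ i j, i < j → j < n → Passes π d₀ (u i) (v i) (q i) (u j) ∧
      Passes π d₀ (u i) (v i) (q i) (v j) := fun i j hij hj =>
    hd i (hij.trans hj) ▸ h.passes i j hij hj
  -- In the two negative directions the copies descend, so they are listed backwards. In all four,
  -- a pin is beyond all the copies: it passes the later ones, and the copy that it slices is itself
  -- further in that direction than the earlier ones.
  have mono' : (∀ i j, i < j → j < n →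
        pinHeight π d₀.1 (q (n - 1 - i)) < pinHeight π d₀.1 (q (n - 1 - j))) ∨
      (∀ i j, i < j → j < n →
        pinHeight π d₀.1 (q (n - 1 - j)) < pinHeight π d₀.1 (q (n - 1 - i))) :=
    mono.symm.imp (fun hm i j hij hj => hm _ _ (by omega) (by omega))
      (fun hm i j hij hj => hm _ _ (by omega) (by omega))
  obtain ⟨_ | _, _ | _⟩ := d₀ <;> simp only [PinOn, Passes] at pin passes <;>
    simp only [pinHeight, if_true, Bool.false_eq_true, if_false] at mono mono'
  · refine exists_sawtooth_of_horizontal_pins (a := fun i => u (n - 1 - i))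
      (b := fun i => v (n - 1 - i)) (q := fun i => q (n - 1 - i))
      ⟨fun k hk => h.lt _ (by omega), fun k hk => h.gt _ (by omega), fun k l hkl hl => ?_,
        fun k l hkl hl => ?_⟩ (fun k hk => ?_) (Or.inr fun k hk j hj => ?_) mono'
    · exact (passes (n - 1 - l) (n - 1 - k) (by omega) (by omega)).2.1
    · exact (passes (n - 1 - l) (n - 1 - k) (by omega) (by omega)).1.2.1
    · have := pin (n - 1 - k) (by omega)
      exact ⟨this.1, this.2.1⟩
    · have h1 := pin (n - 1 - j) (by omega)
      rcases lt_trichotomy (n - 1 - j) (n - 1 - k) with h2 | h2 | h2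
      · have := passes _ _ h2 (by omega)
        omega
      · rw [h2] at h1 ⊢
        exact h1.2.2
      · have := passes _ _ h2 (by omega)
        omega
  · refine exists_sawtooth_of_horizontal_pins (a := u) (b := v) (q := q)
      ⟨h.lt, h.gt, fun k l hkl hl => (passes k l hkl hl).1.1,
        fun k l hkl hl => (passes k l hkl hl).2.2.1⟩ (fun k hk => ⟨(pin k hk).1, (pin k hk).2.1⟩)
      (Or.inl fun k hk j hj => ?_) mono
    have h1 := pin j hj
    rcases lt_trichotomy j k with h2 | rfl | h2
    · have := passes _ _ h2 hk
      omega
    · exact h1.2.2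
    · have := passes _ _ h2 hj
      omega
  · refine exists_sawtooth_of_vertical_pins (a := fun i => u (n - 1 - i))
      (b := fun i => v (n - 1 - i)) (q := fun i => q (n - 1 - i))
      ⟨fun k hk => h.lt _ (by omega), fun k hk => h.gt _ (by omega), fun k l hkl hl => ?_,
        fun k l hkl hl => ?_⟩ (fun k hk => ?_) (Or.inr fun k hk j hj => ?_) mono'
    · exact (passes (n - 1 - l) (n - 1 - k) (by omega) (by omega)).2.1
    · exact (passes (n - 1 - l) (n - 1 - k) (by omega) (by omega)).1.2.1
    · have := pin (n - 1 - k) (by omega)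
      exact ⟨this.1, this.2.1⟩
    · have h1 := pin (n - 1 - j) (by omega)
      rcases lt_trichotomy (n - 1 - j) (n - 1 - k) with h2 | h2 | h2
      · have := passes _ _ h2 (by omega)
        omega
      · rw [h2] at h1 ⊢
        exact h1.2.2
      · have := passes _ _ h2 (by omega)
        omega
  · refine exists_sawtooth_of_vertical_pins (a := u) (b := v) (q := q)
      ⟨h.lt, h.gt, fun k l hkl hl => (passes k l hkl hl).1.1,
        fun k l hkl hl => (passes k l hkl hl).2.2.1⟩ (fun k hk => ⟨(pin k hk).1, (pin k hk).2.1⟩)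
      (Or.inl fun k hk j hj => ?_) mono
    have h1 := pin j hj
    rcases lt_trichotomy j k with h2 | rfl | h2
    · have := passes _ _ h2 hk
      omega
    · exact h1.2.2
    · have := passes _ _ h2 hj
      omega

theorem IsPinFamily.ne {N r : ℕ} {π : Equiv.Perm (Fin N)} {d : ℕ → Bool × Bool}
    {u v q : ℕ → Fin N} (h : IsPinFamily π r d u v q) {i j : ℕ} (hij : i < j) (hj : j < r)
    (hd : d i = d j) : q i ≠ q j := by
  intro he
  have h1 := h.pin i (hij.trans hj)
  have h2 := h.pin j hj
  have h3 := h.passes i j hij hj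
  rw [he, hd] at h1
  rw [he, hd] at h3
  generalize d j = e at *
  obtain ⟨_ | _, _ | _⟩ := e <;> simp only [PinOn, Passes] at h1 h2 h3 <;> omega

theorem IsPinFamily.exists_sawtooth_of_le {N n r : ℕ} {π : Equiv.Perm (Fin N)}
    {d : ℕ → Bool × Bool} {u v q : ℕ → Fin N} (h : IsPinFamily π r d u v q)
    (hr : 4 * 2 ^ (n + n) ≤ r) :
    ∃ σ : Equiv.Perm (Fin (3 * n)),
      (IsParallelSawtooth σ ∨ IsWedgeSawtooth σ) ∧ Contains π σ := by
  obtain ⟨d₀, -, hd₀⟩ := Finset.exists_le_card_fiber_of_mul_le_card_of_maps_to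
    (s := Finset.range r) (t := Finset.univ) (f := d) (n := 2 ^ (n + n))
    (fun _ _ => Finset.mem_univ _) Finset.univ_nonempty (by simpa using hr)
  have hA : ∀ i ∈ (Finset.range r).filter (fun i => d i = d₀), i < r ∧ d i = d₀ := by simp
  have hinj : Set.InjOn (fun i => pinHeight π d₀.1 (q i))
      ((Finset.range r).filter fun i => d i = d₀) := by
    intro i hi j hj hij
    have hq := pinHeight_injective π _ hij
    have hi' := hA i hi
    have hj' := hA j hj
    rcases lt_trichotomy i j with h' | h' | h'
    · exact absurd hq (h.ne h' hj'.1 (hi'.2.trans hj'.2.symm))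
    · exact h'
    · exact absurd hq.symm (h.ne h' hi'.1 (hj'.2.trans hi'.2.symm))
  rcases exists_monotone_subsequence (fun i => pinHeight π d₀.1 (q i)) (n + n) n n _ rfl hinj hd₀
    with ⟨g, hg, hg'⟩ | ⟨g, hg, hg'⟩
  · exact (h.comp (fun i j hij hj => (hg' i j hij hj).1)
      fun i hi => (hA _ (hg i hi)).1).exists_sawtooth
      (fun i hi => (hA _ (hg i hi)).2) (Or.inl fun i j hij hj => (hg' i j hij hj).2)
  · exact (h.comp (fun i j hij hj => (hg' i j hij hj).1)
      fun i hi => (hA _ (hg i hi)).1).exists_sawtooth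
      (fun i hi => (hA _ (hg i hi)).2) (Or.inr fun i j hij hj => (hg' i j hij hj).2)

theorem theorem2 :
    ∃ f : ℕ → ℕ, ∀ (n N : ℕ) (π : Equiv.Perm (Fin N)),
      PermPattern.IsSimple π →
      PermPattern.Contains π (PermPattern.sumOf21 (f n)) →
      (∃ σ : Equiv.Perm (Fin (3 * n)),
        (PermPattern.IsParallelSawtooth σ ∨ PermPattern.IsWedgeSawtooth σ) ∧
          PermPattern.Contains π σ) ∨
      (∃ σ : Equiv.Perm (Fin n),
        PermPattern.IsIncreasingOscillation σ ∧ PermPattern.Contains π σ) := by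
  refine ⟨fun n => nestedPinsBound n (4 * 2 ^ (n + n)), fun n N π hπ hsum => ?_⟩
  by_cases hpath : ∃ y, IsInducedPath π n y
  · obtain ⟨y, hy⟩ := hpath
    exact Or.inr hy.exists_oscillation
  · obtain ⟨a, b, hab⟩ := exists_isSumOf21 hsum ⟨0, lt_of_lt_of_le two_pos hπ.1⟩
    obtain ⟨d, u, v, q, hfam, -⟩ := exists_isPinFamily hπ hpath _ hab
    exact Or.inl (hfam.exists_sawtooth_of_le le_rfl)
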